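/- **Setting.** Let $G$ be an abelian group with a complete translation-invariant metric, $|g|=d(g,0)$ (for example $\mathbb Z$ or $\mathbb Z_2$). $P_k(G)$ is the group of polyhedral $k$-chains in $\mathbb R^3$ with coefficients in $G$ (finite sums $\sum g_i\sigma_i$ of oriented cells, up to orientation and subdivision), with mass $M(P)=\sum|g_i|\,\mathcal H^k(\sigma_i)$ for nonoverlapping $\sigma_i$ and flat norm $M_\flat(P)=\inf\{M(B)+M(C):P=B+\partial C,\ B\in P_k(G),\ C\in P_{k+1}(G)\}$. Flat $k$-chains are the elements of the completion of $P_k(G)$ in $M_\flat$, and the mass $M(A)$ of a flat chain is the infimum of $\liminf M(P_i)$ over all polyhedral $P_i\to A$. For $k\ge1$ a $k$-dipolyhedron is a sum $D=S+T$ of a dipole chain $S=\delta P$, $P\in P_k(G)$, and a mass chain $T=\mu Q$, $Q\in P_{k-1}(G)$ (the group $D_k(G)$ of these is $S_k(G)\oplus T_k(G)$, with $P\mapsto\delta P$ and $Q\mapsto\mu Q$ isomorphisms onto the summands). Its boundary is given by $\partial\delta P=\delta\partial P$ and, for $k\ge2$, $\partial\mu Q=\delta Q-\mu\partial Q$. Its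 weight is $W(D)=M(P)$ and its energy $E(D)=M(P)+M(Q)$. Flat $k$-dipolyhedra are the elements of the completion of $D_k(G)$ in $E_\flat(D)=\inf\{E(B)+E(C):D=B+\partial C,\ B\in D_k(G),\ C\in D_{k+1}(G)\}$; the maps $\partial$ and $\delta$ extend continuously, and the weight $W(A)$ of a flat dipolyhedron is the infimum of $\liminf W(D_i)$ over all dipolyhedra $D_i\to A$. A closed set $F$ supports $A$ if for every open $U\supseteq F$ there are dipolyhedra $D_i\to A$, all of whose closed cells lie in $U$. **Statement.** Let $\gamma:[0,1]\to\mathbb R^3$ be a Lipschitz Jordan curve ($\gamma$ is Lipschitz, $\gamma(0)=\gamma(1)$, and $\gamma$ is injective on $[0,1)$), let $g\in G$, and let $p\in\mathbb R^3$ and $r$ be such that $\gamma$ lies in the closed ball of radius $r$ about $p$. (The cone is nondegenerate if $p\notin\gamma$; this is not required.) Then the inscribed polygons $\gamma_n=\sum_{i<n}g\,[\gamma(i/n),\gamma((i+1)/n)]$ converge to a flat $1$-chain, again denoted $\gamma$, and the cones $p\gamma_n=\sum_{i<n}g\,[p,\gamma(i/n),\gamma((i+1)/n)]$ converge to a flat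 $2$-chain, denoted $p\gamma$. The flat dipolyhedron $D=\delta(p\gamma)$ is supported by the cone over $\gamma$ (the union of the segments from $p$ to the points of $\gamma$) and satisfies $$\partial D=\delta\gamma,\qquad W(D)\le\frac r2\,M(\gamma)<\infty .$$ Hence the class of $2$-dimensional flat dipolyhedra of finite weight with boundary $\delta\gamma$ is nonempty. -/

import Mathlib

open Filter Topology

/-! ### Polyhedral chains -/

/-- Euclidean three-space, in which all cells lie. -/
abbrev R3 : Type := EuclideanSpace ℝ (Fin 3)

/-- Formal finite sums, with coefficients in `G`, of oriented affine `k`-simplices in `ℝ³`; an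
oriented simplex is given by the ordered list of its `k + 1` vertices. -/
abbrev FormalChain (G : Type*) [NormedAddCommGroup G] (k : ℕ) : Type _ :=
  (Fin (k + 1) → R3) →₀ G

section Chains

variable {G : Type*} [NormedAddCommGroup G]

/-- The usual boundary `∂[x₀,…,xₖ₊₁] = ∑ᵢ (-1)ⁱ [x₀,…,x̂ᵢ,…,xₖ₊₁]`. -/
noncomputable def formalBoundary (k : ℕ) : FormalChain G (k + 1) →+ FormalChain G k :=
  Finsupp.liftAddHom fun σ => ∑ i : Fin (k + 2),
    ((-1 : ℤ) ^ (i : ℕ)) • Finsupp.singleAddHom (σ ∘ i.succAbove)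

theorem formalBoundary_single (k : ℕ) (σ : Fin (k + 2) → R3) (g : G) :
    formalBoundary k (Finsupp.single σ g) =
      ∑ i : Fin (k + 2), ((-1 : ℤ) ^ (i : ℕ)) • Finsupp.single (σ ∘ i.succAbove) g := by
  simp [formalBoundary]

theorem formalBoundary_formalBoundary (k : ℕ) (c : FormalChain G (k + 2)) :
    formalBoundary k (formalBoundary (k + 1) c) = 0 := by
  induction c using Finsupp.induction_linear with
  | zero => simp
  | add f g hf hg => rw [map_add, map_add, hf, hg, add_zero]
  | single σ g =>
    rw [formalBoundary_single]
    simp only [map_sum, map_zsmul, formalBoundary_single, Finset.smul_sum, smul_smul]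
    rw [← Finset.sum_product']
    refine Finset.sum_involution
      (fun ij _ => (ij.1.succAbove ij.2, ij.2.predAbove ij.1)) ?_ ?_ ?_ ?_
    · rintro ⟨i, j⟩ -
      have h : (σ ∘ (i.succAbove j).succAbove) ∘ (j.predAbove i).succAbove
          = (σ ∘ i.succAbove) ∘ j.succAbove := by
        funext l
        simp only [Function.comp_apply, Fin.succAbove_succAbove_succAbove_predAbove]
      simp only [h, ← pow_add]
      rw [Fin.neg_one_pow_succAbove_add_predAbove, neg_smul, add_neg_cancel]
    · rintro ⟨i, j⟩ - - h
      exact Fin.succAbove_ne i j (congrArg Prod.fst h)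
    · intro _ _
      simp
    · rintro ⟨i, j⟩ -
      simp [Fin.succAbove_succAbove_predAbove, Fin.predAbove_predAbove_succAbove]

/-- The formal chains that represent the zero polyhedral chain. They are generated by the degenerate
`k`-simplices (those lying in a `(k-1)`-plane) and by the boundaries of degenerate
`(k+1)`-simplices (`(k+1)`-simplices lying in a `k`-plane). The latter relations
contain the rule that an odd permutation of the vertices changes the sign, and the rule that a cell
equals the sum of the pieces of a subdivision, so that two formal chains are identified exactly when
they have the same multiplicity almost everywhere on every oriented `k`-plane; for integer
coefficients this says that the integrals of all smooth `k`-forms over them agree. -/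
noncomputable def nullChains (G : Type*) [NormedAddCommGroup G] (k : ℕ) :
    AddSubgroup (FormalChain G k) :=
  AddSubgroup.closure
    ({c | ∃ (σ : Fin (k + 1) → R3) (g : G), ¬ AffineIndependent ℝ σ ∧ c = Finsupp.single σ g} ∪
     {c | ∃ (σ : Fin (k + 2) → R3) (g : G), ¬ AffineIndependent ℝ σ ∧
        c = formalBoundary k (Finsupp.single σ g)})

/-- The group `P_k(G)` of polyhedral `k`-chains in `ℝ³` with coefficients in `G`. -/
def PolyChain (G : Type*) [NormedAddCommGroup G] (k : ℕ) : Type _ :=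
  FormalChain G k ⧸ nullChains G k

noncomputable instance (k : ℕ) : AddCommGroup (PolyChain G k) :=
  inferInstanceAs (AddCommGroup (FormalChain G k ⧸ nullChains G k))

/-- The polyhedral chain represented by a formal chain. -/
noncomputable def polyMk (k : ℕ) : FormalChain G k →+ PolyChain G k :=
  QuotientAddGroup.mk' (nullChains G k)

theorem polyMk_surjective (k : ℕ) : Function.Surjective (polyMk (G := G) k) :=
  QuotientAddGroup.mk'_surjective _

theorem nullChains_le_comap_formalBoundary (k : ℕ) :
    nullChains G (k + 1) ≤ (nullChains G k).comap (formalBoundary k) := by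
  refine (AddSubgroup.closure_le _).2 ?_
  rintro c (⟨σ, g, hσ, rfl⟩ | ⟨σ, g, hσ, rfl⟩)
  · exact AddSubgroup.subset_closure (Or.inr ⟨σ, g, hσ, rfl⟩)
  · simp only [AddSubgroup.coe_comap, Set.mem_preimage, formalBoundary_formalBoundary]
    exact (nullChains G k).zero_mem

/-- The boundary operator of polyhedral chains. -/
noncomputable def polyBoundary (k : ℕ) : PolyChain G (k + 1) →+ PolyChain G k :=
  QuotientAddGroup.map _ _ (formalBoundary k) (nullChains_le_comap_formalBoundary k)

theorem polyBoundary_polyMk (k : ℕ) (c : FormalChain G (k + 1)) :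
    polyBoundary k (polyMk (k + 1) c) = polyMk k (formalBoundary k c) := rfl

theorem polyBoundary_polyBoundary (k : ℕ) (P : PolyChain G (k + 2)) :
    polyBoundary k (polyBoundary (k + 1) P) = 0 := by
  obtain ⟨c, rfl⟩ := polyMk_surjective _ P
  rw [polyBoundary_polyMk, polyBoundary_polyMk, formalBoundary_formalBoundary, map_zero]

/-- The cone `[x₀,…,xₖ] ↦ [p,x₀,…,xₖ]` with vertex `p`. -/
noncomputable def formalCone (p : R3) (k : ℕ) : FormalChain G k →+ FormalChain G (k + 1) :=
  Finsupp.liftAddHom fun σ => Finsupp.singleAddHom (Fin.cons p σ)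

theorem formalCone_single (p : R3) (k : ℕ) (σ : Fin (k + 1) → R3) (g : G) :
    formalCone p k (Finsupp.single σ g) = Finsupp.single (Fin.cons p σ) g := by
  simp [formalCone]

theorem formalBoundary_formalCone (p : R3) (k : ℕ) (c : FormalChain G (k + 1)) :
    formalBoundary (k + 1) (formalCone p (k + 1) c) = c - formalCone p k (formalBoundary k c) := by
  induction c using Finsupp.induction_linear with
  | zero => simp
  | add f g hf hg => simp only [map_add, hf, hg]; abel
  | single σ g =>
    rw [formalCone_single, formalBoundary_single, formalBoundary_single, Fin.sum_univ_succ,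
      map_sum, sub_eq_add_neg, ← Finset.sum_neg_distrib]
    congr 1
    · simp only [Fin.val_zero, pow_zero, one_smul]
      congr 1
    · refine Finset.sum_congr rfl fun i _ => ?_
      rw [map_zsmul, formalCone_single, Fin.val_succ, pow_succ, mul_neg_one, neg_smul]
      congr 3
      funext j
      refine Fin.cases ?_ (fun l => ?_) j <;> simp

theorem not_affineIndependent_cons (p : R3) {k : ℕ} {σ : Fin (k + 1) → R3}
    (hσ : ¬ AffineIndependent ℝ σ) :
    ¬ AffineIndependent ℝ (Fin.cons p σ : Fin (k + 2) → R3) :=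
  fun h => hσ (h.comp_embedding (Fin.succEmb (k + 1)))

theorem nullChains_le_comap_formalCone (p : R3) (k : ℕ) :
    nullChains G k ≤ (nullChains G (k + 1)).comap (formalCone p k) := by
  refine (AddSubgroup.closure_le _).2 ?_
  rintro c (⟨σ, g, hσ, rfl⟩ | ⟨σ, g, hσ, rfl⟩)
  · exact AddSubgroup.subset_closure
      (Or.inl ⟨_, g, not_affineIndependent_cons p hσ, formalCone_single p k σ g⟩)
  · have h := formalBoundary_formalCone p k (Finsupp.single σ g)
    have h' : formalCone p k (formalBoundary k (Finsupp.single σ g)) = Finsupp.single σ g -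
        formalBoundary (k + 1) (formalCone p (k + 1) (Finsupp.single σ g)) := by
      rw [h]; abel
    simp only [AddSubgroup.coe_comap, Set.mem_preimage, h', formalCone_single, SetLike.mem_coe]
    refine (nullChains G (k + 1)).sub_mem ?_ ?_
    · exact AddSubgroup.subset_closure (Or.inl ⟨σ, g, hσ, rfl⟩)
    · exact AddSubgroup.subset_closure
        (Or.inr ⟨_, g, not_affineIndependent_cons p hσ, rfl⟩)

/-- The cone `pP` over a polyhedral chain `P`, with vertex `p`. -/
noncomputable def polyCone (p : R3) (k : ℕ) : PolyChain G k →+ PolyChain G (k + 1) :=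
  QuotientAddGroup.map _ _ (formalCone p k) (nullChains_le_comap_formalCone p k)

/-! ### Mass and flat norm of polyhedral chains, flat chains -/

/-- The `k`-dimensional volume of the simplex with vertices `x₀,…,xₖ`, that is
`√(det ⟪xᵢ - x₀, xⱼ - x₀⟫) / k!`. This is `1` for `k = 0`, and the length for `k = 1`. -/
noncomputable def simplexVolume {k : ℕ} (σ : Fin (k + 1) → R3) : ℝ :=
  Real.sqrt (Matrix.gram ℝ fun i : Fin k => σ i.succ - σ 0).det / (k.factorial : ℝ)

theorem simplexVolume_nonneg {k : ℕ} (σ : Fin (k + 1) → R3) : 0 ≤ simplexVolume σ := by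
  unfold simplexVolume; positivity

/-- `∑ |gᵢ| M(σᵢ)` for a formal chain `∑ gᵢ σᵢ`, counted with overlaps. -/
noncomputable def formalMass {k : ℕ} (c : FormalChain G k) : ℝ :=
  c.sum fun σ g => ‖g‖ * simplexVolume σ

theorem formalMass_nonneg {k : ℕ} (c : FormalChain G k) : 0 ≤ formalMass c :=
  Finset.sum_nonneg fun σ _ => mul_nonneg (norm_nonneg _) (simplexVolume_nonneg σ)

theorem formalMass_add_le {k : ℕ} (c d : FormalChain G k) :
    formalMass (c + d) ≤ formalMass c + formalMass d := by
  classical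
  have key : ∀ e : FormalChain G k, e.support ⊆ c.support ∪ d.support →
      formalMass e = ∑ σ ∈ c.support ∪ d.support, ‖e σ‖ * simplexVolume σ := fun e he =>
    Finsupp.sum_of_support_subset _ he _ (by simp)
  rw [key _ Finsupp.support_add, key c Finset.subset_union_left,
    key d Finset.subset_union_right, ← Finset.sum_add_distrib]
  refine Finset.sum_le_sum fun σ _ => ?_
  rw [← add_mul]
  exact mul_le_mul_of_nonneg_right (by simpa using norm_add_le (c σ) (d σ))
    (simplexVolume_nonneg σ)

theorem formalMass_neg {k : ℕ} (c : FormalChain G k) : formalMass (-c) = formalMass c := by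
  simp [formalMass, Finsupp.sum]

/-- The mass `M(P)` of a polyhedral chain: the least value of `∑ |gᵢ| M(σᵢ)` over the formal chains
`∑ gᵢ σᵢ` that represent `P`. By the triangle inequality in `G`, passing to a common refinement does
not increase the sum, so that the least value is the one for nonoverlapping `σᵢ`. -/
noncomputable def polyMass (k : ℕ) : AddGroupSeminorm (PolyChain G k) where
  toFun P := sInf {x : ℝ | ∃ c : FormalChain G k, polyMk k c = P ∧ x = formalMass c}
  map_zero' := by
    refine le_antisymm (csInf_le ⟨0, ?_⟩ ⟨0, map_zero _, by simp [formalMass]⟩)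
      (Real.sInf_nonneg ?_) <;>
    · rintro x ⟨c, -, rfl⟩
      exact formalMass_nonneg c
  add_le' P Q := by
    have hb : ∀ R : PolyChain G k,
        BddBelow {x : ℝ | ∃ c : FormalChain G k, polyMk k c = R ∧ x = formalMass c} :=
      fun R => ⟨0, by rintro x ⟨c, -, rfl⟩; exact formalMass_nonneg c⟩
    have hn : ∀ R : PolyChain G k,
        {x : ℝ | ∃ c : FormalChain G k, polyMk k c = R ∧ x = formalMass c}.Nonempty := fun R => by
      obtain ⟨c, hc⟩ := polyMk_surjective k R
      exact ⟨_, c, hc, rfl⟩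
    refine le_of_forall_pos_le_add fun ε hε => ?_
    obtain ⟨_, ⟨c, hc, rfl⟩, hc'⟩ := exists_lt_of_csInf_lt (hn P)
      (lt_add_of_pos_right _ (half_pos hε))
    obtain ⟨_, ⟨d, hd, rfl⟩, hd'⟩ := exists_lt_of_csInf_lt (hn Q)
      (lt_add_of_pos_right _ (half_pos hε))
    have := csInf_le (hb (P + Q)) ⟨c + d, by rw [map_add, hc, hd], rfl⟩
    have := formalMass_add_le c d
    linarith
  neg' P := by
    congr 1
    ext x
    constructor <;>
    · rintro ⟨c, hc, rfl⟩
      exact ⟨-c, by simp [hc], (formalMass_neg c).symm⟩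

/-- Given a group `A` with seminorm `m`, a group `B` with seminorm `m'` and a homomorphism
`d : B → A`, the flat seminorm
`a ↦ inf {m b + m' c : a = b + d c}`. -/
noncomputable def flatSeminorm {A B : Type*} [AddCommGroup A] [AddCommGroup B]
    (m : AddGroupSeminorm A) (m' : AddGroupSeminorm B) (d : B →+ A) : AddGroupSeminorm A where
  toFun a := sInf {x : ℝ | ∃ (b : A) (c : B), a = b + d c ∧ x = m b + m' c}
  map_zero' := by
    refine le_antisymm (csInf_le ⟨0, ?_⟩ ⟨0, 0, by simp, by simp⟩)
      (Real.sInf_nonneg ?_) <;>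
    · rintro x ⟨b, c, -, rfl⟩
      exact add_nonneg (apply_nonneg m b) (apply_nonneg m' c)
  add_le' P Q := by
    have hb : ∀ a : A, BddBelow {x : ℝ | ∃ (b : A) (c : B), a = b + d c ∧ x = m b + m' c} :=
      fun a => ⟨0, by
        rintro x ⟨b, c, -, rfl⟩
        exact add_nonneg (apply_nonneg m b) (apply_nonneg m' c)⟩
    have hn : ∀ a : A, {x : ℝ | ∃ (b : A) (c : B), a = b + d c ∧ x = m b + m' c}.Nonempty :=
      fun a => ⟨_, a, 0, by simp, rfl⟩
    refine le_of_forall_pos_le_add fun ε hε => ?_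
    obtain ⟨_, ⟨b, c, hc, rfl⟩, hc'⟩ := exists_lt_of_csInf_lt (hn P)
      (lt_add_of_pos_right _ (half_pos hε))
    obtain ⟨_, ⟨b', c', hd, rfl⟩, hd'⟩ := exists_lt_of_csInf_lt (hn Q)
      (lt_add_of_pos_right _ (half_pos hε))
    have := csInf_le (hb (P + Q)) ⟨b + b', c + c', by rw [map_add, hc, hd]; abel, rfl⟩
    have := map_add_le_add m b b'
    have := map_add_le_add m' c c'
    linarith
  neg' P := by
    congr 1
    ext x
    constructor
    · rintro ⟨b, c, hc, rfl⟩
      exact ⟨-b, -c, by rw [map_neg, ← neg_add, ← hc, neg_neg], by simp⟩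
    · rintro ⟨b, c, rfl, rfl⟩
      exact ⟨-b, -c, by rw [map_neg, neg_add], by simp⟩

theorem flatSeminorm_le {A B : Type*} [AddCommGroup A] [AddCommGroup B]
    (m : AddGroupSeminorm A) (m' : AddGroupSeminorm B) (d : B →+ A) (b : A) (c : B) :
    flatSeminorm m m' d (b + d c) ≤ m b + m' c :=
  csInf_le ⟨0, by
    rintro x ⟨b, c, -, rfl⟩
    exact add_nonneg (apply_nonneg m b) (apply_nonneg m' c)⟩ ⟨b, c, rfl, rfl⟩

theorem le_flatSeminorm {A B : Type*} [AddCommGroup A] [AddCommGroup B]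
    (m : AddGroupSeminorm A) (m' : AddGroupSeminorm B) (d : B →+ A) (a : A) (x : ℝ)
    (h : ∀ b c, a = b + d c → x ≤ m b + m' c) : x ≤ flatSeminorm m m' d a :=
  le_csInf ⟨_, a, 0, by simp, rfl⟩ (by rintro _ ⟨b, c, hbc, rfl⟩; exact h b c hbc)

/-- `P_k(G)` is normed by the flat norm
`M_♭(P) = inf {M(B) + M(C) : P = B + ∂C, B ∈ P_k(G), C ∈ P_{k+1}(G)}`. -/
noncomputable instance (k : ℕ) : SeminormedAddCommGroup (PolyChain G k) :=
  (flatSeminorm (polyMass k) (polyMass (k + 1)) (polyBoundary k)).toSeminormedAddCommGroup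

theorem polyChain_norm_def (k : ℕ) (P : PolyChain G k) :
    ‖P‖ = flatSeminorm (polyMass k) (polyMass (k + 1)) (polyBoundary k) P := rfl

/-- The group of flat `k`-chains: the completion of `P_k(G)` in the flat norm. -/
abbrev FlatChain (G : Type*) [NormedAddCommGroup G] (k : ℕ) : Type _ :=
  UniformSpace.Completion (PolyChain G k)

/-- The mass of a flat chain `A`: the infimum of `liminf M(Pᵢ)` over all sequences of polyhedral
chains `Pᵢ` that converge to `A` in the flat norm. -/
noncomputable def flatMass {k : ℕ} (A : FlatChain G k) : ENNReal :=
  ⨅ (P : ℕ → PolyChain G k) (_ : Tendsto (fun i => (P i : FlatChain G k)) atTop (𝓝 A)),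
    liminf (fun i => ENNReal.ofReal (polyMass k (P i))) atTop

/-- The polyhedral chain `P` lies in `U`: it is a sum of simplices whose closures are in `U`. -/
def PolyChain.LiesIn {k : ℕ} (P : PolyChain G k) (U : Set R3) : Prop :=
  ∃ c : FormalChain G k, polyMk k c = P ∧ ∀ σ ∈ c.support, convexHull ℝ (Set.range σ) ⊆ U

/-! ### Dipolyhedra -/

/-- The group `D_{k+1}(G) = S_{k+1}(G) ⊕ T_{k+1}(G)` of dipolyhedra of dimension `k + 1`
(note the shift). A dipole chain `∑ gᵢ δσᵢ` of dimension `k + 1` is given by the polyhedral chain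
`∑ gᵢ σᵢ` of dimension `k + 1`, and a mass chain `∑ gᵢ μτᵢ` of dimension `k + 1` by the polyhedral
chain `∑ gᵢ τᵢ` of dimension `k`; the element `(P, Q)` is the dipolyhedron `δP + μQ`. Here `δ` and
`μ` refer to the direction `e₄` normal to `ℝ³` in `ℝ⁴`. -/
def Dipolyhedron (G : Type*) [NormedAddCommGroup G] (k : ℕ) : Type _ :=
  PolyChain G (k + 1) × PolyChain G k

noncomputable instance (k : ℕ) : AddCommGroup (Dipolyhedron G k) :=
  inferInstanceAs (AddCommGroup (PolyChain G (k + 1) × PolyChain G k))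

/-- The dipole chain `δP`. -/
noncomputable def dipole (k : ℕ) : PolyChain G (k + 1) →+ Dipolyhedron G k :=
  AddMonoidHom.inl _ _

/-- The mass chain `μQ`. -/
noncomputable def massCell (k : ℕ) : PolyChain G k →+ Dipolyhedron G k :=
  AddMonoidHom.inr _ _

/-- The polyhedral chain `P` with `S = δP` in `D = S + T`. -/
noncomputable def dipolePart (k : ℕ) : Dipolyhedron G k →+ PolyChain G (k + 1) :=
  AddMonoidHom.fst _ _

/-- The polyhedral chain `Q` with `T = μQ` in `D = S + T`. -/
noncomputable def massPart (k : ℕ) : Dipolyhedron G k →+ PolyChain G k :=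
  AddMonoidHom.snd _ _

@[simp] theorem dipolePart_dipole (k : ℕ) (P : PolyChain G (k + 1)) :
    dipolePart k (dipole k P) = P := rfl

@[simp] theorem massPart_dipole (k : ℕ) (P : PolyChain G (k + 1)) :
    massPart k (dipole k P) = 0 := rfl

@[simp] theorem dipolePart_massCell (k : ℕ) (Q : PolyChain G k) :
    dipolePart k (massCell k Q) = 0 := rfl

@[simp] theorem massPart_massCell (k : ℕ) (Q : PolyChain G k) :
    massPart k (massCell k Q) = Q := rfl

theorem dipolyhedron_ext {k : ℕ} {D D' : Dipolyhedron G k}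
    (h : dipolePart k D = dipolePart k D') (h' : massPart k D = massPart k D') : D = D' :=
  Prod.ext h h'

/-- The boundary operator of dipolyhedra: `∂ δP = δ ∂P` and `∂ μQ = δQ - μ ∂Q` (the latter being
`δQ = μ ∂Q + ∂ μQ`). -/
noncomputable def dipolyBoundary (k : ℕ) : Dipolyhedron G (k + 1) →+ Dipolyhedron G k :=
  (dipole k).comp ((polyBoundary (k + 1)).comp (dipolePart (k + 1))) +
    ((dipole k).comp (massPart (k + 1)) -
      (massCell k).comp ((polyBoundary k).comp (massPart (k + 1))))

theorem dipolyBoundary_dipole (k : ℕ) (P : PolyChain G (k + 2)) :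
    dipolyBoundary k (dipole (k + 1) P) = dipole k (polyBoundary (k + 1) P) := by
  refine dipolyhedron_ext ?_ ?_ <;>
  simp [dipolyBoundary]

theorem dipolyBoundary_massCell (k : ℕ) (Q : PolyChain G (k + 1)) :
    dipolyBoundary k (massCell (k + 1) Q) = dipole k Q - massCell k (polyBoundary k Q) := by
  refine dipolyhedron_ext ?_ ?_ <;>
  simp [dipolyBoundary]

theorem dipolyhedron_eq {k : ℕ} (D : Dipolyhedron G k) :
    D = dipole k (dipolePart k D) + massCell k (massPart k D) := by
  refine dipolyhedron_ext ?_ ?_ <;>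
  simp

theorem dipolyBoundary_dipolyBoundary (k : ℕ) (D : Dipolyhedron G (k + 2)) :
    dipolyBoundary k (dipolyBoundary (k + 1) D) = 0 := by
  rw [dipolyhedron_eq D]
  simp only [map_add, map_sub, dipolyBoundary_dipole, dipolyBoundary_massCell,
    polyBoundary_polyBoundary, map_zero]
  abel

/-- The weight `W(S + T) = W(S)`, where `W(δP) = M(P)`. -/
noncomputable def dipolyWeight (k : ℕ) : AddGroupSeminorm (Dipolyhedron G k) :=
  (polyMass (k + 1)).comp (dipolePart k)

/-- The energy `E(S + T) = W(S) + M(T)`, where `M(μQ) = M(Q)`. -/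
noncomputable def dipolyEnergy (k : ℕ) : AddGroupSeminorm (Dipolyhedron G k) :=
  dipolyWeight k + (polyMass k).comp (massPart k)

/-- The group of dipolyhedra is normed by
`E_♭(D) = inf {E(B) + E(C) : D = B + ∂C}`, where `C` is one dimension higher. -/
noncomputable instance (k : ℕ) : SeminormedAddCommGroup (Dipolyhedron G k) :=
  (flatSeminorm (dipolyEnergy k) (dipolyEnergy (k + 1))
    (dipolyBoundary k)).toSeminormedAddCommGroup

theorem dipolyhedron_norm_def (k : ℕ) (D : Dipolyhedron G k) :
    ‖D‖ = flatSeminorm (dipolyEnergy k) (dipolyEnergy (k + 1)) (dipolyBoundary k) D := rfl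

/-- The group of flat dipolyhedra of dimension `k + 1` (note the shift): the completion in `E_♭`. -/
abbrev FlatDipolyhedron (G : Type*) [NormedAddCommGroup G] (k : ℕ) : Type _ :=
  UniformSpace.Completion (Dipolyhedron G k)

theorem norm_dipolyBoundary_le (k : ℕ) (D : Dipolyhedron G (k + 1)) :
    ‖dipolyBoundary k D‖ ≤ ‖D‖ := by
  rw [dipolyhedron_norm_def (k + 1)]
  refine le_flatSeminorm _ _ _ _ _ ?_
  rintro B C rfl
  rw [map_add, dipolyBoundary_dipolyBoundary, add_zero, dipolyhedron_norm_def]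
  have h := flatSeminorm_le (dipolyEnergy k) (dipolyEnergy (k + 1)) (dipolyBoundary k) 0 B
  rw [zero_add, map_zero, zero_add] at h
  exact h.trans (le_add_of_nonneg_right (apply_nonneg _ _))

theorem dipolyEnergy_dipole (k : ℕ) (P : PolyChain G (k + 1)) :
    dipolyEnergy k (dipole k P) = polyMass (k + 1) P := by
  simp [dipolyEnergy, dipolyWeight]

theorem norm_dipole_le (k : ℕ) (P : PolyChain G (k + 1)) : ‖dipole k P‖ ≤ ‖P‖ := by
  rw [polyChain_norm_def]
  refine le_flatSeminorm _ _ _ _ _ ?_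
  rintro B C rfl
  rw [map_add, ← dipolyBoundary_dipole, dipolyhedron_norm_def]
  refine (flatSeminorm_le _ _ _ _ _).trans ?_
  rw [dipolyEnergy_dipole, dipolyEnergy_dipole]

/-- The boundary operator of flat dipolyhedra (the continuous extension of the boundary operator of
dipolyhedra). -/
noncomputable def flatDipolyBoundary (k : ℕ) :
    NormedAddGroupHom (FlatDipolyhedron G (k + 1)) (FlatDipolyhedron G k) :=
  ((dipolyBoundary k).mkNormedAddGroupHom 1
    (by simpa using norm_dipolyBoundary_le k)).completion

/-- The flat dipolyhedron `δA` of a flat chain `A` (the continuous extension of `P ↦ δP`). -/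
noncomputable def flatDipole (k : ℕ) :
    NormedAddGroupHom (FlatChain G (k + 1)) (FlatDipolyhedron G k) :=
  ((dipole k).mkNormedAddGroupHom 1 (by simpa using norm_dipole_le k)).completion

/-- The weight of a flat dipolyhedron `A`: the infimum of `liminf W(Dᵢ)` over all sequences of
dipolyhedra `Dᵢ` that converge to `A` in `E_♭`. -/
noncomputable def flatWeight {k : ℕ} (A : FlatDipolyhedron G k) : ENNReal :=
  ⨅ (D : ℕ → Dipolyhedron G k) (_ : Tendsto (fun i => (D i : FlatDipolyhedron G k)) atTop (𝓝 A)),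
    liminf (fun i => ENNReal.ofReal (dipolyWeight k (D i))) atTop

/-- The dipolyhedron `δP + μQ` lies in `U`: both `P` and `Q` do. -/
def Dipolyhedron.LiesIn {k : ℕ} (D : Dipolyhedron G k) (U : Set R3) : Prop :=
  (dipolePart k D).LiesIn U ∧ (massPart k D).LiesIn U

/-- The closed set `F` supports the flat dipolyhedron `A`: for every open `U ⊇ F` there is a sequence
of dipolyhedra lying in `U` that converges to `A`. -/
def Supports {k : ℕ} (F : Set R3) (A : FlatDipolyhedron G k) : Prop :=
  IsClosed F ∧ ∀ U : Set R3, IsOpen U → F ⊆ U →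
    ∃ D : ℕ → Dipolyhedron G k, (∀ i, (D i).LiesIn U) ∧
      Tendsto (fun i => (D i : FlatDipolyhedron G k)) atTop (𝓝 A)

/-! ### Lipschitz Jordan curves and the cones over them -/

/-- `γ`, restricted to `[0,1]`, is a Lipschitz parametrization of a Jordan curve: a closed curve
without further self-intersections. -/
def IsLipschitzJordanCurve (γ : ℝ → R3) : Prop :=
  (∃ L : NNReal, LipschitzOnWith L γ (Set.Icc 0 1)) ∧ γ 0 = γ 1 ∧ Set.InjOn γ (Set.Ico 0 1)

/-- The inscribed polygon `∑_{i<n} g [γ(i/n), γ((i+1)/n)]` with coefficient `g`. -/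
noncomputable def inscribedPolygon (γ : ℝ → R3) (g : G) (n : ℕ) : PolyChain G 1 :=
  ∑ i ∈ Finset.range n,
    polyMk 1 (Finsupp.single ![γ ((i : ℝ) / n), γ (((i : ℝ) + 1) / n)] g)

/-- The flat `1`-chain `γ` with coefficient `g`: the limit of the inscribed polygons. -/
noncomputable def curveChain (γ : ℝ → R3) (g : G) : FlatChain G 1 :=
  limUnder atTop fun n => (inscribedPolygon γ g n : FlatChain G 1)

/-- The flat `2`-chain `pγ` with coefficient `g`, the cone over `γ` with vertex `p`: the limit of the
cones over the inscribed polygons. -/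
noncomputable def coneChain (p : R3) (γ : ℝ → R3) (g : G) : FlatChain G 2 :=
  limUnder atTop fun n => (polyCone p 1 (inscribedPolygon γ g n) : FlatChain G 2)

/-- The cone over the curve `γ` with vertex `p`, as a set: the union of the segments that join `p` to
the points of the curve. -/
def coneSet (p : R3) (γ : ℝ → R3) : Set R3 :=
  ⋃ s ∈ Set.Icc (0 : ℝ) 1, segment ℝ p (γ s)

/-- The class of `2`-dimensional flat dipolyhedra of finite weight that span `δA`. -/
def spanningClass (A : FlatChain G 1) : Set (FlatDipolyhedron G 1) :=
  {D | flatDipolyBoundary 0 D = flatDipole 0 A ∧ flatWeight D < ⊤}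

end Chains

/-! Convergence is a sewing argument. Replacing `[a,b] + [b,c]` by `[a,c]` changes a chain by the
boundary of a triangle of area at most `|a-b||b-c|/2`. After coning, `p∂T = T - ∂(pT)` adds only the
volume of a tetrahedron, at most `r|a-b||b-c|/6` when `a` is in the ball. Edges and their cones are
thus additive up to a quadratic error, so refining an inscribed polygon from `n` to `nm` edges costs
`O(1/n)` in flat norm, and both sequences are Cauchy. The boundary formula holds for closed polygons
and passes to the limit by continuity. For the support, each triangle of `pγ_n` lies within `L/n` of
a segment of the cone.

The weight bound is the hard part. `M(γ)` is an infimum over all polyhedral `P_i → γ`, and these may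
leave the ball, where the cone over an edge can have area greater than `r/2` times its length. So
`P_i` is pushed into the ball by the nearest point retraction `f`, which does not expand lengths. As
`f(P_i)` is not polyhedral, its cone `p f(P_i)` is a flat limit of cones over inscribed polygons;
these have vertices in the ball and are no longer than `P_i`, so their cones have mass at most `r/2`
times the length of `P_i`.

It remains to see that `P ↦ p f(P)` is well defined and Lipschitz for the flat norm
(`norm_polyPushCone_le`). This requires bounding the cone over `f(∂σ)` by the area of the triangle
`σ` (`norm_segmentLimit_flatCone_triangle_le`): the longest side is divided at the foot of its
altitude, and almost additivity is applied to the thin strips on both sides of the altitude. Since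
`f` fixes the inscribed polygons of `γ`, the cones `p f(P_i)` converge to `pγ`, and a diagonal
choice of polygons proves the bound (`flatWeight_flatDipole_coneChain_le`). -/

/-! ### Almost additive functions of two points -/

section Sewing

variable {E A : Type*} [NormedAddCommGroup E] [NormedAddCommGroup A]

/-- `F a b + F b c` differs from `F a c` by at most `C |a - b| |b - c|`, for points of `K`. -/
def AlmostAdditiveOn (F : E → E → A) (K : Set E) (C : ℝ) : Prop :=
  ∀ a ∈ K, ∀ b ∈ K, ∀ c ∈ K, ‖F a b + F b c - F a c‖ ≤ C * (dist a b * dist b c)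

/-- The sum of `F` over the edges of the polygon with vertices `w (i / n)`. -/
noncomputable def polygonalSum {E A : Type*} [NormedAddCommGroup A] (F : E → E → A) (w : ℝ → E)
    (n : ℕ) : A :=
  ∑ i ∈ Finset.range n, F (w ((i : ℝ) / n)) (w (((i : ℝ) + 1) / n))

variable {F : E → E → A} {K : Set E} {C : ℝ}

theorem AlmostAdditiveOn.self (hF : AlmostAdditiveOn F K C) {a : E} (ha : a ∈ K) : F a a = 0 := by
  simpa using hF a ha a ha a ha

/-- The polygon is filled by the fan of triangles with common vertex `a 0`, one for each edge. -/
theorem AlmostAdditiveOn.norm_sum_sub_le (hF : AlmostAdditiveOn F K C) (a : ℕ → E) (m : ℕ)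
    (ha : ∀ l ≤ m, a l ∈ K) :
    ‖∑ l ∈ Finset.range m, F (a l) (a (l + 1)) - F (a 0) (a m)‖ ≤
      ∑ l ∈ Finset.range m, C * (dist (a 0) (a l) * dist (a l) (a (l + 1))) := by
  induction m with
  | zero => simp [hF.self (ha 0 le_rfl)]
  | succ m ih =>
    rw [Finset.sum_range_succ, Finset.sum_range_succ]
    have h1 := ih fun l hl => ha l (by omega)
    have h2 := hF _ (ha 0 (by omega)) _ (ha m (by omega)) _ (ha (m + 1) le_rfl)
    refine le_trans ?_ (add_le_add h1 h2)
    refine le_trans (le_of_eq ?_) (norm_add_le _ _)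
    congr 1
    abel

/-- The strip between the two polygons is a ladder of quadrilaterals, each cut by the diagonal from
`u l` to `v (l + 1)`. The two triangles enter with opposite signs, so the diagonals cancel and the
rungs telescope. -/
theorem AlmostAdditiveOn.norm_strip_le (hF : AlmostAdditiveOn F K C) (u v : ℕ → E) (m : ℕ)
    (hu : ∀ l ≤ m, u l ∈ K) (hv : ∀ l ≤ m, v l ∈ K) :
    ‖∑ l ∈ Finset.range m, F (u l) (u (l + 1)) - ∑ l ∈ Finset.range m, F (v l) (v (l + 1)) +
        F (u m) (v m) - F (u 0) (v 0)‖ ≤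
      ∑ l ∈ Finset.range m, (C * (dist (u l) (u (l + 1)) * dist (u (l + 1)) (v (l + 1))) +
        C * (dist (u l) (v l) * dist (v l) (v (l + 1)))) := by
  induction m with
  | zero => simp
  | succ m ih =>
    rw [Finset.sum_range_succ, Finset.sum_range_succ, Finset.sum_range_succ]
    have h1 := ih (fun l hl => hu l (by omega)) (fun l hl => hv l (by omega))
    have h2 := hF _ (hu m (by omega)) _ (hu (m + 1) le_rfl) _ (hv (m + 1) le_rfl)
    have h3 := hF _ (hu m (by omega)) _ (hv m (by omega)) _ (hv (m + 1) le_rfl)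
    refine le_trans ?_ (add_le_add h1 (add_le_add h2 h3))
    rw [← norm_neg (F (u m) (v m) + _ - _)]
    refine le_trans (le_of_eq ?_)
      ((norm_add_le _ _).trans (add_le_add le_rfl (norm_add_le _ _)))
    congr 1
    abel

theorem sum_range_mul_eq {M : Type*} [AddCommMonoid M] (h : ℕ → M) (n m : ℕ) :
    ∑ j ∈ Finset.range (n * m), h j =
      ∑ i ∈ Finset.range n, ∑ l ∈ Finset.range m, h (i * m + l) := by
  induction n with
  | zero => simp
  | succ n ih => rw [Nat.succ_mul, Finset.sum_range_add, ih, Finset.sum_range_succ]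

theorem natCast_div_mem_Icc {i n : ℕ} (h : i ≤ n) : (i : ℝ) / n ∈ Set.Icc (0 : ℝ) 1 :=
  ⟨by positivity, div_le_one_of_le₀ (by exact_mod_cast h) (by positivity)⟩

theorem succ_div_mem_Icc {i n : ℕ} (h : i < n) : ((i : ℝ) + 1) / n ∈ Set.Icc (0 : ℝ) 1 := by
  simpa using natCast_div_mem_Icc (Nat.succ_le_of_lt h)

variable {w : ℝ → E} {L : NNReal}

theorem polygonalSum_congr {E A : Type*} [NormedAddCommGroup A] {F : E → E → A} {w w' : ℝ → E}
    (h : ∀ t ∈ Set.Icc (0 : ℝ) 1, w t = w' t) (n : ℕ) :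
    polygonalSum F w n = polygonalSum F w' n := by
  refine Finset.sum_congr rfl fun i hi => ?_
  rw [Finset.mem_range] at hi
  rw [h _ (natCast_div_mem_Icc hi.le), h _ (succ_div_mem_Icc hi)]

theorem AlmostAdditiveOn.norm_polygonalSum_mul_sub_le (hC : 0 ≤ C) (hF : AlmostAdditiveOn F K C)
    (hw : LipschitzOnWith L w (Set.Icc 0 1)) (hK : ∀ t ∈ Set.Icc (0 : ℝ) 1, w t ∈ K)
    {n m : ℕ} (hn : 0 < n) (hm : 0 < m) :
    ‖polygonalSum F w (n * m) - polygonalSum F w n‖ ≤ C * L ^ 2 / n := by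
  have hn' : (0 : ℝ) < n := by exact_mod_cast hn
  have hm' : (0 : ℝ) < m := by exact_mod_cast hm
  -- Each edge of the `n`-gon is replaced by `m` short ones. The fan has `m` triangles, each costing
  -- at most `C (L/n) (L/(nm))`; summing over the `n` edges leaves `C L² / n`.
  have key : ∀ i ∈ Finset.range n,
      ‖(∑ l ∈ Finset.range m, F (w (((i * m + l : ℕ) : ℝ) / (n * m : ℕ)))
        (w ((((i * m + l : ℕ) : ℝ) + 1) / (n * m : ℕ)))) -
        F (w ((i : ℝ) / n)) (w (((i : ℝ) + 1) / n))‖ ≤ C * L ^ 2 / n ^ 2 := by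
    intro i hi
    rw [Finset.mem_range] at hi
    have hmem : ∀ l ≤ m, ((i * m + l : ℕ) : ℝ) / (n * m : ℕ) ∈ Set.Icc (0 : ℝ) 1 := fun l hl =>
      natCast_div_mem_Icc (by nlinarith)
    have h := hF.norm_sum_sub_le (fun l => w (((i * m + l : ℕ) : ℝ) / (n * m : ℕ))) m
      fun l hl => hK _ (hmem l hl)
    have e0 : ((i * m + 0 : ℕ) : ℝ) / (n * m : ℕ) = i / n := by
      push_cast; field_simp; ring
    have e1 : ((i * m + m : ℕ) : ℝ) / (n * m : ℕ) = (i + 1) / n := by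
      push_cast; field_simp
    have e2 : ∀ l : ℕ, ((i * m + (l + 1) : ℕ) : ℝ) = ((i * m + l : ℕ) : ℝ) + 1 := by
      intro l; push_cast; ring
    have hb : ∀ l ∈ Finset.range m, C * (dist (w (((i * m + 0 : ℕ) : ℝ) / (n * m : ℕ)))
        (w (((i * m + l : ℕ) : ℝ) / (n * m : ℕ))) * dist (w (((i * m + l : ℕ) : ℝ) / (n * m : ℕ)))
          (w (((i * m + (l + 1) : ℕ) : ℝ) / (n * m : ℕ)))) ≤ C * (L / n * (L / (n * m))) := by
      intro l hl
      rw [Finset.mem_range] at hl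
      have hl' : (l : ℝ) ≤ m := by exact_mod_cast hl.le
      refine mul_le_mul_of_nonneg_left (mul_le_mul ?_ ?_ dist_nonneg (by positivity)) hC
      · refine (hw.dist_le_mul _ (hmem 0 (by omega)) _ (hmem l hl.le)).trans ?_
        rw [div_eq_mul_one_div (L : ℝ)]
        refine mul_le_mul_of_nonneg_left ?_ L.2
        rw [dist_comm, Real.dist_eq, ← sub_div]
        push_cast
        rw [show (i : ℝ) * m + l - (i * m + 0) = l by ring, abs_of_nonneg (by positivity),
          div_le_div_iff₀ (by positivity) hn']
        nlinarith
      · refine (hw.dist_le_mul _ (hmem l hl.le) _ (hmem (l + 1) hl)).trans ?_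
        rw [div_eq_mul_one_div (L : ℝ)]
        refine mul_le_mul_of_nonneg_left ?_ L.2
        rw [dist_comm, Real.dist_eq, ← sub_div]
        push_cast
        rw [show (i : ℝ) * m + (l + 1) - (i * m + l) = 1 by ring, abs_of_nonneg (by positivity)]
    have h' := h.trans (Finset.sum_le_sum hb)
    simp only [e2, e0, e1] at h'
    refine h'.trans (le_of_eq ?_)
    rw [Finset.sum_const, Finset.card_range, nsmul_eq_mul]
    field_simp
  unfold polygonalSum
  rw [sum_range_mul_eq, ← Finset.sum_sub_distrib]
  refine (norm_sum_le _ _).trans ((Finset.sum_le_sum key).trans (le_of_eq ?_))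
  rw [Finset.sum_const, Finset.card_range, nsmul_eq_mul]
  field_simp

/-- The subdivisions into `n` and `N` parts need not be nested, so both are compared with their
common refinement into `n * N` parts. -/
theorem AlmostAdditiveOn.cauchySeq_polygonalSum (hC : 0 ≤ C) (hF : AlmostAdditiveOn F K C)
    (hw : LipschitzOnWith L w (Set.Icc 0 1)) (hK : ∀ t ∈ Set.Icc (0 : ℝ) 1, w t ∈ K) :
    CauchySeq (polygonalSum F w) := by
  have hlim : Tendsto (fun n : ℕ => C * L ^ 2 / n) atTop (𝓝 0) :=
    tendsto_const_div_atTop_nhds_zero_nat _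
  rw [Metric.cauchySeq_iff']
  intro ε hε
  obtain ⟨N, hN⟩ := ((hlim.eventually (gt_mem_nhds (half_pos hε))).and
    (eventually_gt_atTop 0)).exists_forall_of_atTop
  refine ⟨N, fun n hn => ?_⟩
  obtain ⟨hn1, hn2⟩ := hN n hn
  obtain ⟨hN1, hN2⟩ := hN N le_rfl
  have h1 := hF.norm_polygonalSum_mul_sub_le hC hw hK hn2 hN2
  have h2 := hF.norm_polygonalSum_mul_sub_le hC hw hK hN2 hn2
  rw [mul_comm N n] at h2
  rw [dist_eq_norm, show polygonalSum F w n - polygonalSum F w N =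
    (polygonalSum F w (n * N) - polygonalSum F w N) -
      (polygonalSum F w (n * N) - polygonalSum F w n) by abel]
  have := norm_sub_le (polygonalSum F w (n * N) - polygonalSum F w N)
    (polygonalSum F w (n * N) - polygonalSum F w n)
  linarith

theorem AlmostAdditiveOn.tendsto_polygonalSum [CompleteSpace A] (hC : 0 ≤ C)
    (hF : AlmostAdditiveOn F K C)
    (hw : LipschitzOnWith L w (Set.Icc 0 1)) (hK : ∀ t ∈ Set.Icc (0 : ℝ) 1, w t ∈ K) :
    Tendsto (polygonalSum F w) atTop (𝓝 (limUnder atTop (polygonalSum F w))) :=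
  (hF.cauchySeq_polygonalSum hC hw hK).tendsto_limUnder

/-! ### Limits over the images of segments under a nonexpanding map -/

variable [NormedSpace ℝ E] {f : E → E}

/-- The limit of the sums of `F` over the edges of the polygons inscribed in `f ∘ [x, y]`. -/
noncomputable def segmentLimit (F : E → E → A) (f : E → E) (x y : E) : A :=
  limUnder atTop (polygonalSum F fun t => f (AffineMap.lineMap x y t))

theorem lipschitzOnWith_comp_lineMap (hf : LipschitzWith 1 f) (x y : E) (s : Set ℝ) :
    LipschitzOnWith (nndist x y) (fun t => f (AffineMap.lineMap x y t)) s := by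
  have h := (hf.comp (lipschitzWith_lineMap (𝕜 := ℝ) x y)).lipschitzOnWith (s := s)
  rwa [one_mul] at h

/-- The ladder has `n` steps of length proportional to `1/n` and, by convexity of the distance,
width at most `d` everywhere. The bound is therefore independent of `n` and survives the limit. -/
theorem AlmostAdditiveOn.norm_polygonalSum_strip_le (hC : 0 ≤ C) (hF : AlmostAdditiveOn F K C)
    (hf : LipschitzWith 1 f) (hK : ∀ x, f x ∈ K) (x y x' y' : E) {d : ℝ} (hx : dist x x' ≤ d)
    (hy : dist y y' ≤ d) {n : ℕ} (hn : 0 < n) :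
    ‖polygonalSum F (fun t => f (AffineMap.lineMap x y t)) n -
      polygonalSum F (fun t => f (AffineMap.lineMap x' y' t)) n + F (f y) (f y') -
        F (f x) (f x')‖ ≤ C * (d * (dist x y + dist x' y')) := by
  have hn' : (0 : ℝ) < n := by exact_mod_cast hn
  have h := hF.norm_strip_le (fun i => f (AffineMap.lineMap x y ((i : ℝ) / n)))
    (fun i => f (AffineMap.lineMap x' y' ((i : ℝ) / n))) n (fun _ _ => hK _) (fun _ _ => hK _)
  have hd : 0 ≤ d := dist_nonneg.trans hx
  have hstep : ∀ (a b : E) (l : ℕ), dist (f (AffineMap.lineMap a b ((l : ℝ) / n)))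
      (f (AffineMap.lineMap a b (((l + 1 : ℕ) : ℝ) / n))) ≤ dist a b / n := by
    intro a b l
    refine (hf.dist_le_mul _ _).trans ?_
    rw [NNReal.coe_one, one_mul, dist_lineMap_lineMap, Real.dist_eq, ← sub_div]
    push_cast
    rw [sub_add_cancel_left, abs_div, abs_neg, abs_one, abs_of_pos hn', one_div_mul_eq_div]
  have hacross : ∀ l ≤ n, dist (f (AffineMap.lineMap x y ((l : ℝ) / n)))
      (f (AffineMap.lineMap x' y' ((l : ℝ) / n))) ≤ d := by
    intro l hl
    refine (hf.dist_le_mul _ _).trans ?_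
    obtain ⟨h0, h1⟩ := natCast_div_mem_Icc hl
    rw [NNReal.coe_one, one_mul]
    rw [dist_eq_norm, AffineMap.lineMap_apply_module, AffineMap.lineMap_apply_module,
      show ∀ t : ℝ, (1 - t) • x + t • y - ((1 - t) • x' + t • y') =
        (1 - t) • (x - x') + t • (y - y') by intro t; module]
    refine (norm_add_le _ _).trans ?_
    rw [norm_smul, norm_smul, Real.norm_of_nonneg h0, Real.norm_of_nonneg (sub_nonneg.2 h1),
      ← dist_eq_norm, ← dist_eq_norm]
    nlinarith
  have hb : ∀ l ∈ Finset.range n,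
      (C * (dist (f (AffineMap.lineMap x y ((l : ℝ) / n)))
          (f (AffineMap.lineMap x y (((l + 1 : ℕ) : ℝ) / n))) *
        dist (f (AffineMap.lineMap x y (((l + 1 : ℕ) : ℝ) / n)))
          (f (AffineMap.lineMap x' y' (((l + 1 : ℕ) : ℝ) / n)))) +
      C * (dist (f (AffineMap.lineMap x y ((l : ℝ) / n)))
          (f (AffineMap.lineMap x' y' ((l : ℝ) / n))) *
        dist (f (AffineMap.lineMap x' y' ((l : ℝ) / n)))
          (f (AffineMap.lineMap x' y' (((l + 1 : ℕ) : ℝ) / n))))) ≤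
      C * (dist x y / n * d) + C * (d * (dist x' y' / n)) := by
    intro l hl
    rw [Finset.mem_range] at hl
    exact add_le_add
      (mul_le_mul_of_nonneg_left (mul_le_mul (hstep _ _ _) (hacross _ hl) dist_nonneg
        (by positivity)) hC)
      (mul_le_mul_of_nonneg_left (mul_le_mul (hacross _ hl.le) (hstep _ _ _) dist_nonneg hd) hC)
  have h' := h.trans (Finset.sum_le_sum hb)
  simp only [Nat.cast_zero, zero_div, AffineMap.lineMap_apply_zero, div_self hn'.ne',
    AffineMap.lineMap_apply_one, Nat.cast_add, Nat.cast_one, Finset.sum_const, Finset.card_range,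
    nsmul_eq_mul] at h'
  refine h'.trans (le_of_eq ?_)
  field_simp

variable [CompleteSpace A]

theorem AlmostAdditiveOn.tendsto_segmentLimit (hC : 0 ≤ C) (hF : AlmostAdditiveOn F K C)
    (hf : LipschitzWith 1 f) (hK : ∀ x, f x ∈ K) (x y : E) :
    Tendsto (polygonalSum F fun t => f (AffineMap.lineMap x y t)) atTop
      (𝓝 (segmentLimit F f x y)) :=
  hF.tendsto_polygonalSum hC (lipschitzOnWith_comp_lineMap hf x y _) fun _ _ => hK _

theorem AlmostAdditiveOn.segmentLimit_self (hC : 0 ≤ C) (hF : AlmostAdditiveOn F K C)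
    (hf : LipschitzWith 1 f) (hK : ∀ x, f x ∈ K) (x : E) : segmentLimit F f x x = 0 := by
  refine tendsto_nhds_unique (hF.tendsto_segmentLimit hC hf hK x x) ?_
  refine tendsto_const_nhds.congr fun n => (Finset.sum_eq_zero fun i _ => ?_).symm
  simp [hF.self (hK x)]

theorem AlmostAdditiveOn.segmentLimit_swap (hC : 0 ≤ C) (hF : AlmostAdditiveOn F K C)
    (hF' : ∀ a b, F a b = -F b a) (hf : LipschitzWith 1 f) (hK : ∀ x, f x ∈ K) (x y : E) :
    segmentLimit F f x y = -segmentLimit F f y x := by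
  refine tendsto_nhds_unique (hF.tendsto_segmentLimit hC hf hK x y) ?_
  refine (hF.tendsto_segmentLimit hC hf hK y x).neg.congr fun n => ?_
  unfold polygonalSum
  rw [← Finset.sum_range_reflect, ← Finset.sum_neg_distrib]
  refine Finset.sum_congr rfl fun i hi => ?_
  rw [Finset.mem_range] at hi
  have hn : (n : ℝ) ≠ 0 := by
    have : n ≠ 0 := by omega
    exact_mod_cast this
  have e : ((n - 1 - i : ℕ) : ℝ) = n - 1 - i := by
    rw [Nat.sub_sub, Nat.cast_sub (by omega)]; push_cast; ring
  simp only []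
  rw [← hF', e, ← AffineMap.lineMap_apply_one_sub x y, ← AffineMap.lineMap_apply_one_sub x y]
  congr 3 <;> · field_simp; ring

/-- At a rational parameter `k/m` the dividing point is a vertex of every subdivision into `m * s`
parts, where the sum splits exactly into `k * s` and `(m - k) * s` terms. Passing to this
subsequence gives exact additivity. -/
theorem AlmostAdditiveOn.segmentLimit_add (hC : 0 ≤ C) (hF : AlmostAdditiveOn F K C)
    (hf : LipschitzWith 1 f) (hK : ∀ x, f x ∈ K) (x z : E) {k m : ℕ} (hm : 0 < m) (hkm : k ≤ m) :
    segmentLimit F f x z = segmentLimit F f x (AffineMap.lineMap x z ((k : ℝ) / m)) +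
      segmentLimit F f (AffineMap.lineMap x z ((k : ℝ) / m)) z := by
  have hm' : (m : ℝ) ≠ 0 := by exact_mod_cast hm.ne'
  rcases Nat.eq_zero_or_pos k with rfl | hk
  · simp [hF.segmentLimit_self hC hf hK]
  obtain ⟨l, rfl⟩ := Nat.exists_eq_add_of_le hkm
  rcases Nat.eq_zero_or_pos l with rfl | hl
  · rw [show ((k : ℝ) / (k + 0 : ℕ)) = 1 by simpa using div_self hm', AffineMap.lineMap_apply_one,
      hF.segmentLimit_self hC hf hK, add_zero]
  have hsub : ∀ q : ℕ, 0 < q → Tendsto (fun s : ℕ => q * s) atTop atTop := fun q hq =>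
    Filter.tendsto_id.const_mul_atTop' hq
  refine tendsto_nhds_unique ((hF.tendsto_segmentLimit hC hf hK x z).comp (hsub _ hm))
    ((((hF.tendsto_segmentLimit hC hf hK x _).comp (hsub _ hk)).add
      ((hF.tendsto_segmentLimit hC hf hK _ z).comp (hsub _ hl))).congr' ?_)
  filter_upwards [eventually_gt_atTop 0] with s hs
  have hs' : (s : ℝ) ≠ 0 := by exact_mod_cast hs.ne'
  have hk' : (k : ℝ) ≠ 0 := by exact_mod_cast hk.ne'
  have hl' : (l : ℝ) ≠ 0 := by exact_mod_cast hl.ne'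
  have hkl : (k : ℝ) + l ≠ 0 := by exact_mod_cast hm.ne'
  simp only [Function.comp_apply, polygonalSum]
  rw [add_mul k l s, Finset.sum_range_add]
  have e1 : ∀ t : ℝ, AffineMap.lineMap x (AffineMap.lineMap x z ((k : ℝ) / (k + l : ℕ)))
      (t / (k * s : ℕ)) = AffineMap.lineMap x z (t / (k * s + l * s : ℕ)) := by
    intro t
    rw [AffineMap.lineMap_lineMap_right]
    congr 1
    push_cast
    rw [← add_mul]
    field_simp
  have e2 : ∀ t : ℝ, AffineMap.lineMap (AffineMap.lineMap x z ((k : ℝ) / (k + l : ℕ))) z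
      (t / (l * s : ℕ)) = AffineMap.lineMap x z ((k * s + t) / (k * s + l * s : ℕ)) := by
    intro t
    rw [AffineMap.lineMap_lineMap_left]
    congr 1
    push_cast
    rw [← add_mul]
    field_simp
    ring
  congr 1
  · refine Finset.sum_congr rfl fun i _ => ?_
    rw [e1, e1]
  · refine Finset.sum_congr rfl fun i _ => ?_
    rw [e2, e2]
    push_cast
    rw [add_assoc]

/-- Two strips, one pinched at `x` and one at `z`, share the rung from `f w` to `f y`, which cancels
in their sum. -/
theorem AlmostAdditiveOn.norm_segmentLimit_sub_le (hC : 0 ≤ C) (hF : AlmostAdditiveOn F K C)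
    (hf : LipschitzWith 1 f) (hK : ∀ x, f x ∈ K) (x y z w : E) :
    ‖segmentLimit F f x w + segmentLimit F f w z - segmentLimit F f x y - segmentLimit F f y z‖ ≤
      C * (dist w y * (dist x w + dist x y + dist w z + dist y z)) := by
  have T := hF.tendsto_segmentLimit hC hf hK
  refine le_of_tendsto ((((T x w).add (T w z)).sub (T x y)).sub (T y z)).norm ?_
  filter_upwards [eventually_gt_atTop 0] with n hn
  have h1 := hF.norm_polygonalSum_strip_le hC hf hK x w x y (d := dist w y) (by simp) le_rfl hn
  have h2 := hF.norm_polygonalSum_strip_le hC hf hK w z y z (d := dist w y) le_rfl (by simp) hn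
  rw [hF.self (hK x), sub_zero] at h1
  rw [hF.self (hK z), add_zero] at h2
  refine le_trans ?_ ((add_le_add h1 h2).trans (le_of_eq (by ring)))
  refine le_trans (le_of_eq ?_) (norm_add_le _ _)
  congr 1
  abel

/-- The side `[x, z]` is divided at a point `w` and the detour through `w` is compared with the one
through `y`; all four lengths are at most `dist x z`. Additivity at `w` is known only for rational
parameters, so `q` is approximated by `⌊q * m⌋₊ / m`. With `q` the foot of the altitude, the right
side becomes a multiple of the area. -/
theorem AlmostAdditiveOn.norm_segmentLimit_triangle_le (hC : 0 ≤ C) (hF : AlmostAdditiveOn F K C)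
    (hf : LipschitzWith 1 f) (hK : ∀ x, f x ∈ K) (x y z : E) (hxy : dist x y ≤ dist x z)
    (hyz : dist y z ≤ dist x z) {q : ℝ} (hq : q ∈ Set.Icc (0 : ℝ) 1) :
    ‖segmentLimit F f x y + segmentLimit F f y z - segmentLimit F f x z‖ ≤
      4 * C * (dist (AffineMap.lineMap x z q) y * dist x z) := by
  have key : ∀ m : ℕ, 0 < m → ‖segmentLimit F f x y + segmentLimit F f y z - segmentLimit F f x z‖ ≤
      4 * C * (dist (AffineMap.lineMap x z ((⌊q * m⌋₊ : ℝ) / m)) y * dist x z) := by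
    intro m hm
    have hm' : (0 : ℝ) < m := by exact_mod_cast hm
    have hk : ⌊q * m⌋₊ ≤ m := by
      refine Nat.floor_le_of_le ?_
      nlinarith [hq.2]
    set w : E := AffineMap.lineMap x z ((⌊q * m⌋₊ : ℝ) / m) with hw
    have h := hF.norm_segmentLimit_sub_le hC hf hK x y z w
    rw [← hF.segmentLimit_add hC hf hK x z hm hk] at h
    obtain ⟨h0, h1⟩ := natCast_div_mem_Icc hk
    have hxw : dist x w ≤ dist x z := by
      rw [hw, dist_left_lineMap, Real.norm_of_nonneg h0]
      nlinarith [dist_nonneg (x := x) (y := z)]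
    have hwz : dist w z ≤ dist x z := by
      rw [hw, dist_lineMap_right, Real.norm_of_nonneg (by linarith)]
      nlinarith [dist_nonneg (x := x) (y := z)]
    rw [← norm_neg]
    refine le_trans (le_of_eq ?_) (h.trans ?_)
    · congr 1
      abel
    · have : dist w y * (dist x w + dist x y + dist w z + dist y z) ≤
          dist w y * (4 * dist x z) := mul_le_mul_of_nonneg_left (by linarith) dist_nonneg
      calc _ ≤ C * (dist w y * (4 * dist x z)) := mul_le_mul_of_nonneg_left this hC
        _ = _ := by ring
  have hlim : Tendsto (fun m : ℕ => (⌊q * m⌋₊ : ℝ) / m) atTop (𝓝 q) :=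
    (tendsto_nat_floor_mul_div_atTop hq.1).comp tendsto_natCast_atTop_atTop
  have hcont : Continuous fun s : ℝ =>
      4 * C * (dist (AffineMap.lineMap x z s) y * dist x z) := by
    have : Continuous fun s : ℝ => AffineMap.lineMap x z s :=
      (lipschitzWith_lineMap (𝕜 := ℝ) x z).continuous
    fun_prop
  refine ge_of_tendsto ((hcont.tendsto q).comp hlim) ?_
  filter_upwards [eventually_gt_atTop 0] with m hm
  exact key m hm

end Sewing

/-! ### Volumes of simplices of low dimension -/

theorem simplexVolume_edge (a b : R3) : simplexVolume ![a, b] = dist a b := by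
  simp [simplexVolume, Matrix.gram_apply, dist_eq_norm, norm_sub_rev]

theorem simplexVolume_triangle (a b c : R3) : simplexVolume ![a, b, c] =
    √(‖b - a‖ ^ 2 * ‖c - a‖ ^ 2 - inner ℝ (b - a) (c - a) ^ 2) / 2 := by
  simp only [simplexVolume, Matrix.det_fin_two, Matrix.gram_apply]
  simp [real_inner_comm, pow_two]

/-- With `u = b - a` and `v = c - b`, the Gram determinant equals `|u|²|v|² - ⟪u,v⟫²`. -/
theorem simplexVolume_triangle_le (a b c : R3) :
    simplexVolume ![a, b, c] ≤ dist a b * dist b c / 2 := by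
  rw [simplexVolume_triangle]
  refine div_le_div_of_nonneg_right (Real.sqrt_le_iff.2 ⟨by positivity, ?_⟩) zero_le_two
  obtain ⟨u, rfl⟩ : ∃ u, b = a + u := ⟨b - a, by abel⟩
  obtain ⟨v, rfl⟩ : ∃ v, c = a + u + v := ⟨c - (a + u), by abel⟩
  rw [show a + u + v - a = u + v by abel, add_sub_cancel_left, dist_self_add_right,
    dist_self_add_right, inner_add_right, norm_add_sq_real, real_inner_self_eq_norm_sq]
  nlinarith [sq_nonneg (inner ℝ u v)]

/-- The Gram matrix is `V Vᵀ` for the square coordinate matrix `V`, so its determinant is `(det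
V)²`. -/
theorem gram_fin_three (v : Fin 3 → R3) : (Matrix.gram ℝ v).det =
    (v 0 0 * (v 1 1 * v 2 2 - v 1 2 * v 2 1) - v 0 1 * (v 1 0 * v 2 2 - v 1 2 * v 2 0) +
      v 0 2 * (v 1 0 * v 2 1 - v 1 1 * v 2 0)) ^ 2 := by
  have h : Matrix.gram ℝ v = (Matrix.of fun i l => v i l) * (Matrix.of fun i l => v i l).transpose := by
    ext i j
    simp [Matrix.gram_apply, Matrix.mul_apply, PiLp.inner_apply, mul_comm]
  rw [h, Matrix.det_mul, Matrix.det_transpose, Matrix.det_fin_three]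
  simp only [Matrix.of_apply]
  ring

/-- Hadamard's inequality for three vectors: Lagrange's identity is used once for `a` and `b × c`,
once for `b` and `c`. -/
theorem triple_product_sq_le (a0 a1 a2 b0 b1 b2 c0 c1 c2 : ℝ) :
    (a0 * (b1 * c2 - b2 * c1) - a1 * (b0 * c2 - b2 * c0) + a2 * (b0 * c1 - b1 * c0)) ^ 2 ≤
      (a0 ^ 2 + a1 ^ 2 + a2 ^ 2) * ((b0 ^ 2 + b1 ^ 2 + b2 ^ 2) * (c0 ^ 2 + c1 ^ 2 + c2 ^ 2)) := by
  have lagrange : ∀ x0 x1 x2 y0 y1 y2 : ℝ,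
      (x0 ^ 2 + x1 ^ 2 + x2 ^ 2) * (y0 ^ 2 + y1 ^ 2 + y2 ^ 2) = (x0 * y0 + x1 * y1 + x2 * y2) ^ 2 +
        ((x1 * y2 - x2 * y1) ^ 2 + (x2 * y0 - x0 * y2) ^ 2 + (x0 * y1 - x1 * y0) ^ 2) := by
    intros; ring
  have h1 := lagrange a0 a1 a2 (b1 * c2 - b2 * c1) (b2 * c0 - b0 * c2) (b0 * c1 - b1 * c0)
  have h2 := lagrange b0 b1 b2 c0 c1 c2
  calc _ = (a0 * (b1 * c2 - b2 * c1) + a1 * (b2 * c0 - b0 * c2) + a2 * (b0 * c1 - b1 * c0)) ^ 2 := by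
        ring
    _ ≤ (a0 ^ 2 + a1 ^ 2 + a2 ^ 2) * ((b1 * c2 - b2 * c1) ^ 2 + (b2 * c0 - b0 * c2) ^ 2 +
        (b0 * c1 - b1 * c0) ^ 2) := by rw [h1]; exact le_add_of_nonneg_right (by positivity)
    _ ≤ _ := by
        rw [h2]
        exact mul_le_mul_of_nonneg_left (le_add_of_nonneg_left (by positivity)) (by positivity)

/-- The determinant of the edge vectors from `p` equals that of the successive edges `a - p`, `b -
a`, `c - b`, to which Hadamard's inequality applies. -/
theorem simplexVolume_tetrahedron_le (p a b c : R3) :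
    simplexVolume (Fin.cons p ![a, b, c]) ≤ dist a p * (dist a b * dist b c) / 6 := by
  unfold simplexVolume
  rw [gram_fin_three, show ((Nat.factorial 3 : ℕ) : ℝ) = 6 by norm_num [Nat.factorial]]
  refine div_le_div_of_nonneg_right (Real.sqrt_le_iff.2 ⟨by positivity, ?_⟩) (by norm_num)
  have h := triple_product_sq_le ((a - p) 0) ((a - p) 1) ((a - p) 2) ((b - a) 0) ((b - a) 1)
    ((b - a) 2) ((c - b) 0) ((c - b) 1) ((c - b) 2)
  have hn : ∀ x y : R3, dist x y ^ 2 = (y - x) 0 ^ 2 + (y - x) 1 ^ 2 + (y - x) 2 ^ 2 := by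
    intro x y
    rw [dist_comm, EuclideanSpace.dist_eq, Real.sq_sqrt (by positivity), Fin.sum_univ_three]
    simp [Real.dist_eq, sq_abs]
  rw [mul_pow, mul_pow, dist_comm a p, hn, hn, hn]
  refine le_trans (le_of_eq ?_) h
  change _ = ((a 0 - p 0) * ((b 1 - a 1) * (c 2 - b 2) - (b 2 - a 2) * (c 1 - b 1)) -
    (a 1 - p 1) * ((b 0 - a 0) * (c 2 - b 2) - (b 2 - a 2) * (c 0 - b 0)) +
    (a 2 - p 2) * ((b 0 - a 0) * (c 1 - b 1) - (b 1 - a 1) * (c 0 - b 0))) ^ 2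
  change ((a 0 - p 0) * ((b 1 - p 1) * (c 2 - p 2) - (b 2 - p 2) * (c 1 - p 1)) -
    (a 1 - p 1) * ((b 0 - p 0) * (c 2 - p 2) - (b 2 - p 2) * (c 0 - p 0)) +
    (a 2 - p 2) * ((b 0 - p 0) * (c 1 - p 1) - (b 1 - p 1) * (c 0 - p 0))) ^ 2 = _
  ring

section Edges

variable {G : Type*} [NormedAddCommGroup G]

/-! ### Estimates for polyhedral chains -/

theorem formalMass_single {k : ℕ} (σ : Fin (k + 1) → R3) (g : G) :
    formalMass (Finsupp.single σ g) = ‖g‖ * simplexVolume σ :=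
  Finsupp.sum_single_index (by simp)

theorem polyMass_polyMk_le {k : ℕ} (c : FormalChain G k) :
    polyMass k (polyMk k c) ≤ formalMass c :=
  csInf_le ⟨0, by rintro x ⟨c, -, rfl⟩; exact formalMass_nonneg c⟩ ⟨c, rfl, rfl⟩

theorem exists_formalMass_lt {k : ℕ} (P : PolyChain G k) {ε : ℝ} (hε : 0 < ε) :
    ∃ c : FormalChain G k, polyMk k c = P ∧ formalMass c < polyMass k P + ε := by
  obtain ⟨c₀, hc₀⟩ := polyMk_surjective k P
  obtain ⟨_, ⟨c, hc, rfl⟩, hlt⟩ := exists_lt_of_csInf_lt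
    (s := {x : ℝ | ∃ c : FormalChain G k, polyMk k c = P ∧ x = formalMass c})
    ⟨_, c₀, hc₀, rfl⟩ (lt_add_of_pos_right _ hε)
  exact ⟨c, hc, hlt⟩

theorem norm_le_polyMass {k : ℕ} (P : PolyChain G k) : ‖P‖ ≤ polyMass k P := by
  have h := flatSeminorm_le (polyMass k) (polyMass (k + 1)) (polyBoundary (G := G) k) P 0
  rwa [map_zero, map_zero, add_zero, add_zero] at h

theorem norm_polyBoundary_le {k : ℕ} (P : PolyChain G (k + 1)) :
    ‖polyBoundary k P‖ ≤ polyMass (k + 1) P := by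
  have h := flatSeminorm_le (polyMass k) (polyMass (k + 1)) (polyBoundary (G := G) k) 0 P
  rwa [map_zero, zero_add, zero_add] at h

theorem polyBoundary_polyCone (p : R3) (k : ℕ) (P : PolyChain G (k + 1)) :
    polyBoundary (k + 1) (polyCone p (k + 1) P) = P - polyCone p k (polyBoundary k P) := by
  obtain ⟨c, rfl⟩ := polyMk_surjective _ P
  exact (congrArg (polyMk (k + 1)) (formalBoundary_formalCone p k c)).trans (map_sub _ _ _)

theorem polyMk_single_of_not_affineIndependent {k : ℕ} {σ : Fin (k + 1) → R3}
    (hσ : ¬ AffineIndependent ℝ σ) (g : G) : polyMk k (Finsupp.single σ g) = 0 :=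
  (QuotientAddGroup.eq_zero_iff _).2 (AddSubgroup.subset_closure (Or.inl ⟨σ, g, hσ, rfl⟩))

/-- The oriented segment `[a, b]` with coefficient `g`. -/
noncomputable def edge (a b : R3) : G →+ PolyChain G 1 :=
  (polyMk 1).comp (Finsupp.singleAddHom ![a, b])

theorem edge_apply (a b : R3) (g : G) : edge a b g = polyMk 1 (Finsupp.single ![a, b] g) := rfl

theorem polyBoundary_triangle (a b c : R3) (g : G) :
    polyBoundary 1 (polyMk 2 (Finsupp.single ![a, b, c] g)) =
      edge a b g + edge b c g - edge a c g := by
  have e0 : ![a, b, c] ∘ Fin.succAbove 0 = ![b, c] := by ext i; fin_cases i <;> rfl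
  have e1 : ![a, b, c] ∘ Fin.succAbove 1 = ![a, c] := by ext i; fin_cases i <;> rfl
  have e2 : ![a, b, c] ∘ Fin.succAbove 2 = ![a, b] := by ext i; fin_cases i <;> rfl
  rw [polyBoundary_polyMk, formalBoundary_single, Fin.sum_univ_three]
  simp only [e0, e1, e2, map_add, map_zsmul, ← edge_apply]
  simp
  abel

theorem edge_self (a : R3) (g : G) : edge a a g = 0 :=
  polyMk_single_of_not_affineIndependent
    (fun h => absurd (h.injective (a₁ := 0) (a₂ := 1) rfl) (by simp)) g

theorem edge_swap (a b : R3) (g : G) : edge a b g = -edge b a g := by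
  have h := polyBoundary_triangle a b a g
  rw [polyMk_single_of_not_affineIndependent
    (fun h => absurd (h.injective (a₁ := 0) (a₂ := 2) rfl) (by simp)) g, map_zero, edge_self,
    sub_zero] at h
  exact eq_neg_of_add_eq_zero_left h.symm

theorem norm_edge_triangle_le (a b c : R3) (g : G) :
    ‖edge a b g + edge b c g - edge a c g‖ ≤ ‖g‖ / 2 * (dist a b * dist b c) := by
  rw [← polyBoundary_triangle]
  refine (norm_polyBoundary_le _).trans ((polyMass_polyMk_le _).trans ?_)
  rw [formalMass_single]
  have := mul_le_mul_of_nonneg_left (simplexVolume_triangle_le a b c) (norm_nonneg g)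
  linarith

theorem polyCone_edge (p a b : R3) (g : G) :
    polyCone p 1 (edge a b g) = polyMk 2 (Finsupp.single (Fin.cons p ![a, b]) g) :=
  congrArg (polyMk 2) (formalCone_single p 1 ![a, b] g)

/-- By the cone formula, `p∂T = T - ∂(pT)`: the triangle contributes `1/2`, and the tetrahedron,
whose edge from `p` to `a` is at most `r`, contributes `r/6`. -/
theorem norm_polyCone_edge_triangle_le {p : R3} {r : ℝ} {a : R3}
    (ha : a ∈ Metric.closedBall p r) (b c : R3) (g : G) :
    ‖polyCone p 1 (edge a b g) + polyCone p 1 (edge b c g) - polyCone p 1 (edge a c g)‖ ≤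
      ‖g‖ * (1 / 2 + r / 6) * (dist a b * dist b c) := by
  set T : PolyChain G 2 := polyMk 2 (Finsupp.single ![a, b, c] g) with hT
  have hcone : polyCone p 1 (polyBoundary 1 T) = T - polyBoundary 2 (polyCone p 2 T) := by
    rw [polyBoundary_polyCone]; abel
  have h1 : ‖T‖ ≤ ‖g‖ * (dist a b * dist b c / 2) := by
    refine (norm_le_polyMass _).trans ((polyMass_polyMk_le _).trans ?_)
    rw [formalMass_single]
    exact mul_le_mul_of_nonneg_left (simplexVolume_triangle_le a b c) (norm_nonneg g)
  have h2 : ‖polyBoundary 2 (polyCone p 2 T)‖ ≤ ‖g‖ * (r * (dist a b * dist b c) / 6) := by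
    have e : polyCone p 2 T = polyMk 3 (Finsupp.single (Fin.cons p ![a, b, c]) g) :=
      congrArg (polyMk 3) (formalCone_single p 2 ![a, b, c] g)
    rw [e]
    refine (norm_polyBoundary_le _).trans ((polyMass_polyMk_le _).trans ?_)
    rw [formalMass_single]
    refine mul_le_mul_of_nonneg_left ((simplexVolume_tetrahedron_le p a b c).trans ?_)
      (norm_nonneg g)
    have : dist a p * (dist a b * dist b c) ≤ r * (dist a b * dist b c) :=
      mul_le_mul_of_nonneg_right ha (by positivity)
    linarith
  rw [← map_add, ← map_sub, ← polyBoundary_triangle, hcone]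
  refine (norm_sub_le _ _).trans ((add_le_add h1 h2).trans (le_of_eq (by ring)))

/-! ### Edges as almost additive functions with values in flat chains -/

/-- The inclusion of polyhedral chains in flat chains. -/
noncomputable def polyToFlat (k : ℕ) : PolyChain G k →+ FlatChain G k :=
  UniformSpace.Completion.toCompl

theorem polyToFlat_apply {k : ℕ} (P : PolyChain G k) : polyToFlat k P = (P : FlatChain G k) := rfl

theorem norm_polyToFlat {k : ℕ} (P : PolyChain G k) : ‖polyToFlat k P‖ = ‖P‖ :=
  UniformSpace.Completion.norm_coe P

/-- The segment `[a, b]` with coefficient `g` as a flat chain. -/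
noncomputable def flatEdge (g : G) (a b : R3) : FlatChain G 1 := polyToFlat 1 (edge a b g)

/-- The triangle `[p, a, b]` with coefficient `g` as a flat chain. -/
noncomputable def flatCone (p : R3) (g : G) (a b : R3) : FlatChain G 2 :=
  polyToFlat 2 (polyCone p 1 (edge a b g))

theorem almostAdditiveOn_flatEdge (g : G) :
    AlmostAdditiveOn (flatEdge g) Set.univ (‖g‖ / 2) := fun a _ b _ c _ => by
  simp only [flatEdge, ← map_add, ← map_sub]
  rw [norm_polyToFlat]
  exact norm_edge_triangle_le a b c g

theorem almostAdditiveOn_flatCone (p : R3) (r : ℝ) (g : G) :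
    AlmostAdditiveOn (flatCone p g) (Metric.closedBall p r) (‖g‖ * (1 / 2 + r / 6)) :=
  fun a ha b _ c _ => by
    unfold flatCone
    rw [← map_add, ← map_sub, norm_polyToFlat]
    exact norm_polyCone_edge_triangle_le ha b c g

theorem flatCone_swap (p : R3) (g : G) (a b : R3) : flatCone p g a b = -flatCone p g b a := by
  unfold flatCone
  rw [edge_swap, map_neg, map_neg]

theorem coe_inscribedPolygon (γ : ℝ → R3) (g : G) (n : ℕ) :
    (inscribedPolygon γ g n : FlatChain G 1) = polygonalSum (flatEdge g) γ n := by
  rw [← polyToFlat_apply, inscribedPolygon, map_sum]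
  rfl

theorem coe_polyCone_inscribedPolygon (p : R3) (γ : ℝ → R3) (g : G) (n : ℕ) :
    (polyCone p 1 (inscribedPolygon γ g n) : FlatChain G 2) = polygonalSum (flatCone p g) γ n := by
  rw [← polyToFlat_apply, inscribedPolygon, map_sum, map_sum]
  rfl

theorem tendsto_inscribedPolygon (g : G) {γ : ℝ → R3} {L : NNReal}
    (hγ : LipschitzOnWith L γ (Set.Icc 0 1)) :
    Tendsto (fun n => (inscribedPolygon γ g n : FlatChain G 1)) atTop (𝓝 (curveChain γ g)) := by
  unfold curveChain
  simp only [coe_inscribedPolygon]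
  exact (almostAdditiveOn_flatEdge g).tendsto_polygonalSum (by positivity) hγ
    fun _ _ => Set.mem_univ _

theorem tendsto_polyCone_inscribedPolygon (g : G) {γ : ℝ → R3} {L : NNReal}
    (hγ : LipschitzOnWith L γ (Set.Icc 0 1)) {p : R3} {r : ℝ} (hr : 0 ≤ r)
    (hp : ∀ t ∈ Set.Icc (0 : ℝ) 1, γ t ∈ Metric.closedBall p r) :
    Tendsto (fun n => (polyCone p 1 (inscribedPolygon γ g n) : FlatChain G 2)) atTop
      (𝓝 (coneChain p γ g)) := by
  unfold coneChain
  simp only [coe_polyCone_inscribedPolygon]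
  exact (almostAdditiveOn_flatCone p r g).tendsto_polygonalSum (by positivity) hγ hp

end Edges

/-! ### Nearest point retraction on a ball -/

/-- The map is the nearest point projection. Adding the variational inequalities at `x` and `y`
gives `‖f x - f y‖² ≤ ⟪x - y, f x - f y⟫`, and Cauchy–Schwarz finishes. -/
theorem exists_nonexpanding_retraction {p : R3} {r : ℝ} (hr : 0 ≤ r) :
    ∃ f : R3 → R3, LipschitzWith 1 f ∧ (∀ x, f x ∈ Metric.closedBall p r) ∧
      ∀ x ∈ Metric.closedBall p r, f x = x := by
  have hconv := convex_closedBall p r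
  choose f hfK hf using exists_norm_eq_iInf_of_complete_convex
    ⟨p, Metric.mem_closedBall_self hr⟩ Metric.isClosed_closedBall.isComplete hconv
  have hin : ∀ x, ∀ w ∈ Metric.closedBall p r, inner ℝ (x - f x) (w - f x) ≤ 0 := fun x =>
    (norm_eq_iInf_iff_real_inner_le_zero hconv (hfK x)).1 (hf x)
  refine ⟨f, LipschitzWith.of_dist_le_mul fun x y => ?_, hfK, fun x hx => ?_⟩
  · have h1 := hin x _ (hfK y)
    have h2 := hin y _ (hfK x)
    have h3 : ‖f x - f y‖ ^ 2 ≤ inner ℝ (x - y) (f x - f y) := by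
      rw [← real_inner_self_eq_norm_sq]
      simp only [inner_sub_left, inner_sub_right] at h1 h2 ⊢
      linarith
    have h4 := h3.trans (real_inner_le_norm _ _)
    rw [NNReal.coe_one, one_mul, dist_eq_norm, dist_eq_norm]
    rcases (norm_nonneg (f x - f y)).eq_or_lt with h0 | h0
    · rw [← h0]; positivity
    · nlinarith
  · have h := hin x x hx
    rw [real_inner_self_eq_norm_sq] at h
    have : ‖x - f x‖ = 0 := by nlinarith [norm_nonneg (x - f x)]
    exact (sub_eq_zero.1 (norm_eq_zero.1 this)).symm

/-! ### Areas of triangles -/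

theorem simplexVolume_triangle_rotate (a b c : R3) :
    simplexVolume ![b, c, a] = simplexVolume ![a, b, c] := by
  rw [simplexVolume_triangle, simplexVolume_triangle]
  congr 2
  obtain ⟨u, rfl⟩ : ∃ u, b = a + u := ⟨b - a, by abel⟩
  obtain ⟨v, rfl⟩ : ∃ v, c = a + v := ⟨c - a, by abel⟩
  rw [add_sub_cancel_left, add_sub_cancel_left, show a + v - (a + u) = v - u by abel,
    show a - (a + u) = -u by abel, norm_sub_sq_real, norm_neg, inner_neg_right, inner_sub_left,
    real_inner_self_eq_norm_sq, real_inner_comm u v]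
  ring

/-- The angles at both ends of a longest side are not obtuse, so the foot of the altitude lies on
that side; base times height is twice the area. -/
theorem exists_foot_on_longest_side (x y z : R3) (hxy : dist x y ≤ dist x z)
    (hyz : dist y z ≤ dist x z) : ∃ q ∈ Set.Icc (0 : ℝ) 1,
      dist (AffineMap.lineMap x z q) y * dist x z = 2 * simplexVolume ![x, y, z] := by
  rw [simplexVolume_triangle]
  obtain ⟨u, rfl⟩ : ∃ u, y = x + u := ⟨y - x, by abel⟩
  obtain ⟨v, rfl⟩ : ∃ v, z = x + v := ⟨z - x, by abel⟩
  rw [add_sub_cancel_left, add_sub_cancel_left, dist_self_add_right]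
  rw [dist_self_add_right, dist_self_add_right] at hxy
  rw [dist_self_add_right, dist_add_left, dist_eq_norm] at hyz
  rcases eq_or_ne v 0 with rfl | hv
  · refine ⟨0, by simp, ?_⟩
    simp
  have hv' : 0 < ‖v‖ ^ 2 := by positivity
  have h1 : ‖u - v‖ ^ 2 ≤ ‖v‖ ^ 2 := pow_le_pow_left₀ (norm_nonneg _) hyz 2
  have h2 : ‖u‖ ^ 2 ≤ ‖v‖ ^ 2 := pow_le_pow_left₀ (norm_nonneg _) hxy 2
  have hcs := real_inner_le_norm u v
  rw [norm_sub_sq_real] at h1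
  -- The projection parameter is nonnegative because `‖u - v‖ ≤ ‖v‖` forces `2⟪u,v⟫ ≥ ‖u‖²`, and at
  -- most `1` by Cauchy–Schwarz and `‖u‖ ≤ ‖v‖`.
  refine ⟨inner ℝ u v / ‖v‖ ^ 2, ⟨div_nonneg (by nlinarith [sq_nonneg ‖u‖]) hv'.le,
    div_le_one_of_le₀ (by nlinarith [norm_nonneg v]) hv'.le⟩, ?_⟩
  rw [mul_div_cancel₀ _ (two_ne_zero), ← Real.sqrt_sq (norm_nonneg v),
    ← Real.sqrt_sq (dist_nonneg), ← Real.sqrt_mul (sq_nonneg _), Real.sqrt_sq (norm_nonneg v)]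
  congr 1
  rw [AffineMap.lineMap_apply_module', add_sub_cancel_left, add_comm, dist_add_left, dist_eq_norm,
    norm_sub_sq_real, norm_smul, inner_smul_left, mul_pow, Real.norm_eq_abs, sq_abs,
    real_inner_comm u v]
  simp only [conj_trivial]
  field_simp
  ring

/-- This turns estimates by volume into the vanishing of homomorphisms on the generators of
`nullChains`. -/
theorem simplexVolume_eq_zero {k : ℕ} {σ : Fin (k + 1) → R3} (hσ : ¬ AffineIndependent ℝ σ) :
    simplexVolume σ = 0 := by
  have h : ¬ LinearIndependent ℝ fun i : Fin k => σ i.succ - σ 0 := by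
    intro h
    refine hσ ((affineIndependent_iff_linearIndependent_vsub ℝ σ 0).2 ?_)
    rw [← linearIndependent_equiv (finSuccAboveEquiv (0 : Fin (k + 1)))]
    exact h
  have hdet : (Matrix.gram ℝ fun i : Fin k => σ i.succ - σ 0).det = 0 := by
    by_contra hne
    exact h (Matrix.posDef_gram_iff_linearIndependent.1
      ((Matrix.posSemidef_gram ℝ _).posDef_iff_det_ne_zero.2 hne))
  rw [simplexVolume, hdet, Real.sqrt_zero, zero_div]

/-! ### Cones over the images of polyhedral chains under a nonexpanding map into the ball -/

section PushCone

variable {G : Type*} [NormedAddCommGroup G]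

theorem seminorm_le_formalMass {k : ℕ} {B : Type*} [AddCommGroup B] (q : AddGroupSeminorm B)
    (φ : FormalChain G k →+ B) {c : ℝ}
    (h : ∀ σ g, q (φ (Finsupp.single σ g)) ≤ c * (‖g‖ * simplexVolume σ)) (d : FormalChain G k) :
    q (φ d) ≤ c * formalMass d := by
  conv_lhs => rw [← Finsupp.sum_single d]
  rw [Finsupp.sum, map_sum, formalMass, Finsupp.sum, Finset.mul_sum]
  exact (Finset.le_sum_of_subadditive q (map_zero q).le (map_add_le_add q) _ _).trans
    (Finset.sum_le_sum fun σ _ => h σ _)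

/-- The boundary of a triangle with collinear vertices is null, so edges on one line add exactly,
whatever the order of the points. -/
theorem edge_add_edge_lineMap (x y : R3) (s t u : ℝ) (g : G) :
    edge (AffineMap.lineMap x y s) (AffineMap.lineMap x y t) g +
      edge (AffineMap.lineMap x y t) (AffineMap.lineMap x y u) g =
        edge (AffineMap.lineMap x y s) (AffineMap.lineMap x y u) g := by
  have h := polyBoundary_triangle (AffineMap.lineMap x y s : R3) (AffineMap.lineMap x y t)
    (AffineMap.lineMap x y u) g
  rw [polyMk_single_of_not_affineIndependent, map_zero] at h
  · exact sub_eq_zero.1 h.symm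
  · rw [affineIndependent_iff_not_collinear_set, not_not,
      collinear_iff_exists_forall_eq_smul_vadd]
    refine ⟨x, y - x, ?_⟩
    simp only [Set.mem_insert_iff, Set.mem_singleton_iff, AffineMap.lineMap_apply]
    rintro _ (rfl | rfl | rfl)
    exacts [⟨s, rfl⟩, ⟨t, rfl⟩, ⟨u, rfl⟩]

theorem sum_edge_lineMap (x y : R3) (g : G) (a : ℕ → ℝ) (n : ℕ) :
    ∑ i ∈ Finset.range n, edge (AffineMap.lineMap x y (a i)) (AffineMap.lineMap x y (a (i + 1))) g =
      edge (AffineMap.lineMap x y (a 0)) (AffineMap.lineMap x y (a n)) g := by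
  induction n with
  | zero => simp [edge_self]
  | succ n ih => rw [Finset.sum_range_succ, ih, edge_add_edge_lineMap]

/-- The polygon with `n` edges inscribed in the image of an edge under `f`, extended to formal
chains. -/
noncomputable def inscribedImage (f : R3 → R3) (n : ℕ) : FormalChain G 1 →+ PolyChain G 1 :=
  Finsupp.liftAddHom fun σ => ∑ i ∈ Finset.range n,
    edge (f (AffineMap.lineMap (σ 0) (σ 1) ((i : ℝ) / n)))
      (f (AffineMap.lineMap (σ 0) (σ 1) (((i : ℝ) + 1) / n)))

theorem inscribedImage_single (f : R3 → R3) (n : ℕ) (σ : Fin 2 → R3) (g : G) :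
    inscribedImage f n (Finsupp.single σ g) = ∑ i ∈ Finset.range n,
      edge (f (AffineMap.lineMap (σ 0) (σ 1) ((i : ℝ) / n)))
        (f (AffineMap.lineMap (σ 0) (σ 1) (((i : ℝ) + 1) / n))) g := by
  simp [inscribedImage]

theorem polyToFlat_polyCone_inscribedImage_single (p : R3) (f : R3 → R3) (n : ℕ) (σ : Fin 2 → R3)
    (g : G) : polyToFlat 2 (polyCone p 1 (inscribedImage f n (Finsupp.single σ g))) =
      polygonalSum (flatCone p g) (fun t => f (AffineMap.lineMap (σ 0) (σ 1) t)) n := by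
  rw [inscribedImage_single, map_sum, map_sum]
  rfl

variable {p : R3} {r : ℝ} {f : R3 → R3}

theorem polyMass_polyCone_edge_le {a b : R3} (ha : a ∈ Metric.closedBall p r) (g : G) :
    polyMass 2 (polyCone p 1 (edge a b g)) ≤ r / 2 * (‖g‖ * dist a b) := by
  rw [polyCone_edge]
  refine (polyMass_polyMk_le _).trans ?_
  rw [formalMass_single]
  have h := simplexVolume_triangle_le p a b
  have h' : dist p a * dist a b ≤ r * dist a b :=
    mul_le_mul_of_nonneg_right (by rw [dist_comm]; exact ha) dist_nonneg
  have := mul_le_mul_of_nonneg_left (h.trans (div_le_div_of_nonneg_right h' zero_le_two))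
    (norm_nonneg g)
  exact this.trans (le_of_eq (by ring))

theorem simplexVolume_eq_dist (σ : Fin 2 → R3) : simplexVolume σ = dist (σ 0) (σ 1) := by
  rw [← simplexVolume_edge]
  congr 1
  ext i
  fin_cases i <;> rfl

/-- Each of the `n` edges inscribed in the image of a segment has length at most `1/n` of that
segment, and starts in the ball, where the cone over an edge has area at most `r/2` times its
length. -/
theorem polyMass_polyCone_inscribedImage_le (hr : 0 ≤ r) (hf : LipschitzWith 1 f)
    (hK : ∀ x, f x ∈ Metric.closedBall p r) (n : ℕ) (c : FormalChain G 1) :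
    polyMass 2 (polyCone p 1 (inscribedImage f n c)) ≤ r / 2 * formalMass c := by
  refine seminorm_le_formalMass (polyMass 2) ((polyCone p 1).comp (inscribedImage f n))
    (fun σ g => ?_) c
  rw [AddMonoidHom.comp_apply, inscribedImage_single, map_sum, simplexVolume_eq_dist]
  rcases Nat.eq_zero_or_pos n with rfl | hn
  · simp only [Finset.range_zero, Finset.sum_empty, map_zero]; positivity
  have hn' : (0 : ℝ) < n := by exact_mod_cast hn
  have key : ∀ i ∈ Finset.range n, polyMass 2 (polyCone p 1
      (edge (f (AffineMap.lineMap (σ 0) (σ 1) ((i : ℝ) / n)))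
        (f (AffineMap.lineMap (σ 0) (σ 1) (((i : ℝ) + 1) / n))) g)) ≤
      r / 2 * (‖g‖ * (dist (σ 0) (σ 1) / n)) := by
    intro i _
    refine (polyMass_polyCone_edge_le (hK _) g).trans (mul_le_mul_of_nonneg_left
      (mul_le_mul_of_nonneg_left ?_ (norm_nonneg _)) (by positivity))
    refine (hf.dist_le_mul _ _).trans ?_
    rw [NNReal.coe_one, one_mul, dist_lineMap_lineMap, Real.dist_eq, ← sub_div,
      sub_add_cancel_left, abs_div, abs_neg, abs_one, abs_of_pos hn', one_div_mul_eq_div]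
  refine (Finset.le_sum_of_subadditive (polyMass 2) (map_zero _).le (map_add_le_add _) _ _).trans
    ((Finset.sum_le_sum key).trans (le_of_eq ?_))
  rw [Finset.sum_const, Finset.card_range, nsmul_eq_mul]
  field_simp

theorem tendsto_segmentLimit_flatCone (hr : 0 ≤ r) (hf : LipschitzWith 1 f)
    (hK : ∀ x, f x ∈ Metric.closedBall p r) (g : G) (x y : R3) :
    Tendsto (polygonalSum (flatCone p g) fun t => f (AffineMap.lineMap x y t)) atTop
      (𝓝 (segmentLimit (flatCone p g) f x y)) :=
  (almostAdditiveOn_flatCone p r g).tendsto_segmentLimit (by positivity) hf hK x y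

/-- The cone with vertex `p` over the image of a formal chain under `f`. -/
noncomputable def pushCone (hr : 0 ≤ r) (hf : LipschitzWith 1 f)
    (hK : ∀ x, f x ∈ Metric.closedBall p r) : FormalChain G 1 →+ FlatChain G 2 :=
  Finsupp.liftAddHom fun σ => AddMonoidHom.mk'
    (fun g => segmentLimit (flatCone p g) f (σ 0) (σ 1)) fun g h => by
      have T := fun g : G => tendsto_segmentLimit_flatCone hr hf hK g (σ 0) (σ 1)
      refine tendsto_nhds_unique (T (g + h)) (((T g).add (T h)).congr fun n => ?_)
      simp only [polygonalSum, flatCone, map_add, Finset.sum_add_distrib]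

theorem pushCone_single (hr : 0 ≤ r) (hf : LipschitzWith 1 f)
    (hK : ∀ x, f x ∈ Metric.closedBall p r) (σ : Fin 2 → R3) (g : G) :
    pushCone hr hf hK (Finsupp.single σ g) = segmentLimit (flatCone p g) f (σ 0) (σ 1) :=
  Finsupp.liftAddHom_apply_single _ _ _

theorem tendsto_pushCone (hr : 0 ≤ r) (hf : LipschitzWith 1 f)
    (hK : ∀ x, f x ∈ Metric.closedBall p r) (c : FormalChain G 1) :
    Tendsto (fun n => polyToFlat 2 (polyCone p 1 (inscribedImage f n c))) atTop
      (𝓝 (pushCone hr hf hK c)) := by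
  induction c using Finsupp.induction_linear with
  | zero => simp
  | add c d hc hd => simpa only [map_add] using hc.add hd
  | single σ g =>
    simp only [polyToFlat_polyCone_inscribedImage_single, pushCone_single]
    exact tendsto_segmentLimit_flatCone hr hf hK g _ _

theorem norm_pushCone_le (hr : 0 ≤ r) (hf : LipschitzWith 1 f)
    (hK : ∀ x, f x ∈ Metric.closedBall p r) (c : FormalChain G 1) :
    ‖pushCone hr hf hK c‖ ≤ r / 2 * formalMass c := by
  refine le_of_tendsto (tendsto_pushCone hr hf hK c).norm (Eventually.of_forall fun n => ?_)
  rw [norm_polyToFlat]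
  exact (norm_le_polyMass _).trans (polyMass_polyCone_inscribedImage_le hr hf hK n c)

/-- The expression is unchanged up to sign when the vertices are rotated cyclically, so the longest
side may be taken opposite to the middle vertex. There the constant `4 * C` meets base times height,
twice the area, which gives the factor `8`. -/
theorem norm_segmentLimit_flatCone_triangle_le (hr : 0 ≤ r) (hf : LipschitzWith 1 f)
    (hK : ∀ x, f x ∈ Metric.closedBall p r) (g : G) (x y z : R3) :
    ‖segmentLimit (flatCone p g) f x y + segmentLimit (flatCone p g) f y z -
      segmentLimit (flatCone p g) f x z‖ ≤
        8 * (1 / 2 + r / 6) * (‖g‖ * simplexVolume ![x, y, z]) := by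
  have hC : 0 ≤ ‖g‖ * (1 / 2 + r / 6) := by positivity
  have hF := almostAdditiveOn_flatCone p r g
  have swap := hF.segmentLimit_swap hC (flatCone_swap p g) hf hK
  have key : ∀ x y z : R3, dist x y ≤ dist x z → dist y z ≤ dist x z →
      ‖segmentLimit (flatCone p g) f x y + segmentLimit (flatCone p g) f y z -
        segmentLimit (flatCone p g) f x z‖ ≤
          8 * (1 / 2 + r / 6) * (‖g‖ * simplexVolume ![x, y, z]) := by
    intro x y z hxy hyz
    obtain ⟨q, hq, hfoot⟩ := exists_foot_on_longest_side x y z hxy hyz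
    have h := hF.norm_segmentLimit_triangle_le hC hf hK x y z hxy hyz hq
    rw [hfoot] at h
    exact h.trans (le_of_eq (by ring))
  rcases le_total (dist x y) (dist x z) with h1 | h1
  · rcases le_total (dist y z) (dist x z) with h2 | h2
    · exact key x y z h1 h2
    · have h := key z x y (by rwa [dist_comm z x, dist_comm z y])
        (by rw [dist_comm z y]; exact h1.trans h2)
      rw [← simplexVolume_triangle_rotate z x y, swap z x, swap z y] at h
      refine le_trans (le_of_eq ?_) h
      congr 1
      abel
  · rcases le_total (dist y z) (dist x y) with h2 | h2
    · have h := key y z x (by rwa [dist_comm y x]) (by rwa [dist_comm z x, dist_comm y x])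
      rw [simplexVolume_triangle_rotate x y z, swap z x, swap y x] at h
      refine le_trans (le_of_eq ?_) h
      congr 1
      abel
    · have h := key z x y (by rw [dist_comm z x, dist_comm z y]; exact h1.trans h2)
        (by rwa [dist_comm z y])
      rw [← simplexVolume_triangle_rotate z x y, swap z x, swap z y] at h
      refine le_trans (le_of_eq ?_) h
      congr 1
      abel

theorem norm_pushCone_formalBoundary_le (hr : 0 ≤ r) (hf : LipschitzWith 1 f)
    (hK : ∀ x, f x ∈ Metric.closedBall p r) (d : FormalChain G 2) :
    ‖pushCone hr hf hK (formalBoundary 1 d)‖ ≤ 8 * (1 / 2 + r / 6) * formalMass d := by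
  refine seminorm_le_formalMass (normAddGroupSeminorm _)
    ((pushCone hr hf hK).comp (formalBoundary 1)) (fun σ g => ?_) d
  have e : σ = ![σ 0, σ 1, σ 2] := by ext i; fin_cases i <;> rfl
  have h := norm_segmentLimit_flatCone_triangle_le hr hf hK g (σ 0) (σ 1) (σ 2)
  rw [← e] at h
  have hσ : pushCone hr hf hK (formalBoundary 1 (Finsupp.single σ g)) =
      segmentLimit (flatCone p g) f (σ 0) (σ 1) + segmentLimit (flatCone p g) f (σ 1) (σ 2) -
        segmentLimit (flatCone p g) f (σ 0) (σ 2) := by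
    rw [formalBoundary_single, Fin.sum_univ_three, map_add, map_add, map_zsmul, map_zsmul,
      map_zsmul, pushCone_single, pushCone_single, pushCone_single]
    change (-1 : ℤ) ^ 0 • segmentLimit _ f (σ 1) (σ 2) +
      (-1 : ℤ) ^ 1 • segmentLimit _ f (σ 0) (σ 2) +
        (-1 : ℤ) ^ 2 • segmentLimit _ f (σ 0) (σ 1) = _
    simp
    abel
  rw [← hσ] at h
  exact h

/-- Both kinds of generators come from simplices of volume zero, so the two preceding bounds make
their images have norm zero, hence vanish in the completion. -/
theorem nullChains_le_ker_pushCone (hr : 0 ≤ r) (hf : LipschitzWith 1 f)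
    (hK : ∀ x, f x ∈ Metric.closedBall p r) :
    nullChains G 1 ≤ (pushCone (G := G) hr hf hK).ker := by
  refine (AddSubgroup.closure_le _).2 ?_
  rintro c (⟨σ, g, hσ, rfl⟩ | ⟨σ, g, hσ, rfl⟩)
  · have h := norm_pushCone_le hr hf hK (Finsupp.single σ g)
    rw [formalMass_single, simplexVolume_eq_zero hσ, mul_zero, mul_zero] at h
    exact norm_le_zero_iff.1 h
  · have h := norm_pushCone_formalBoundary_le hr hf hK (Finsupp.single σ g)
    rw [formalMass_single, simplexVolume_eq_zero hσ, mul_zero, mul_zero] at h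
    exact norm_le_zero_iff.1 h

/-- The cone with vertex `p` over the image of a polyhedral chain under `f`. -/
noncomputable def polyPushCone (hr : 0 ≤ r) (hf : LipschitzWith 1 f)
    (hK : ∀ x, f x ∈ Metric.closedBall p r) : PolyChain G 1 →+ FlatChain G 2 :=
  QuotientAddGroup.lift (nullChains G 1) (pushCone hr hf hK)
    (nullChains_le_ker_pushCone hr hf hK)

theorem polyPushCone_polyMk (hr : 0 ≤ r) (hf : LipschitzWith 1 f)
    (hK : ∀ x, f x ∈ Metric.closedBall p r) (c : FormalChain G 1) :
    polyPushCone hr hf hK (polyMk 1 c) = pushCone hr hf hK c := rfl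

theorem norm_polyPushCone_le (hr : 0 ≤ r) (hf : LipschitzWith 1 f)
    (hK : ∀ x, f x ∈ Metric.closedBall p r) (P : PolyChain G 1) :
    ‖polyPushCone hr hf hK P‖ ≤ 8 * (1 / 2 + r / 6) * ‖P‖ := by
  have hκ : 0 < 8 * (1 / 2 + r / 6) := by positivity
  rw [← div_le_iff₀' hκ, polyChain_norm_def]
  -- In a decomposition `B + ∂C`, the image of `B` is controlled by length and that of `∂C` by area.
  -- Both constants are at most `8 * (1 / 2 + r / 6)`, and the error `ε` is shared equally between
  -- the formal representatives of `B` and `C`.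
  refine le_flatSeminorm _ _ _ _ _ ?_
  rintro B C rfl
  rw [div_le_iff₀' hκ]
  refine le_of_forall_pos_le_add fun ε hε => ?_
  have hη : 0 < ε / (2 * (8 * (1 / 2 + r / 6))) := by positivity
  obtain ⟨b, rfl, hb⟩ := exists_formalMass_lt B hη
  obtain ⟨c, rfl, hc⟩ := exists_formalMass_lt C hη
  rw [polyBoundary_polyMk, map_add, polyPushCone_polyMk, polyPushCone_polyMk]
  have h1 := norm_pushCone_le hr hf hK b
  have h2 := norm_pushCone_formalBoundary_le hr hf hK c
  have h3 : r / 2 * formalMass b ≤ 8 * (1 / 2 + r / 6) * formalMass b :=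
    mul_le_mul_of_nonneg_right (by linarith) (formalMass_nonneg b)
  calc _ ≤ 8 * (1 / 2 + r / 6) * formalMass b + 8 * (1 / 2 + r / 6) * formalMass c :=
        (norm_add_le _ _).trans (add_le_add (h1.trans h3) h2)
    _ ≤ 8 * (1 / 2 + r / 6) * (polyMass 1 (polyMk 1 b) + ε / (2 * (8 * (1 / 2 + r / 6)))) +
        8 * (1 / 2 + r / 6) * (polyMass 2 (polyMk 2 c) + ε / (2 * (8 * (1 / 2 + r / 6)))) := by
      gcongr
    _ = _ := by field_simp; ring

/-- The ball is convex, so `f` fixes the whole segment; the inscribed polygons then all equal the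
edge itself. -/
theorem polyPushCone_edge (hr : 0 ≤ r) (hf : LipschitzWith 1 f)
    (hK : ∀ x, f x ∈ Metric.closedBall p r) (hfix : ∀ x ∈ Metric.closedBall p r, f x = x)
    {a b : R3} (ha : a ∈ Metric.closedBall p r) (hb : b ∈ Metric.closedBall p r) (g : G) :
    polyPushCone hr hf hK (edge a b g) = polyToFlat 2 (polyCone p 1 (edge a b g)) := by
  rw [edge_apply, polyPushCone_polyMk, pushCone_single]
  refine tendsto_nhds_unique (tendsto_segmentLimit_flatCone hr hf hK g _ _)
    (tendsto_const_nhds.congr' ?_)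
  filter_upwards [eventually_gt_atTop 0] with n hn
  have hn' : (n : ℝ) ≠ 0 := by exact_mod_cast hn.ne'
  change _ = polygonalSum (flatCone p g) (fun t => f (AffineMap.lineMap a b t)) n
  rw [polygonalSum_congr (w' := fun t => AffineMap.lineMap a b t) fun t ht => hfix _
    ((convex_closedBall p r).lineMap_mem ha hb ht)]
  have h := sum_edge_lineMap a b g (fun i => (i : ℝ) / n) n
  rw [Nat.cast_zero, zero_div, div_self hn', AffineMap.lineMap_apply_zero,
    AffineMap.lineMap_apply_one] at h
  rw [← edge_apply, ← h, map_sum, map_sum]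
  simp only [polygonalSum, flatCone, Nat.cast_add, Nat.cast_one]

end PushCone

section MainTheorem

variable {G : Type*} [NormedAddCommGroup G]

/-! ### Mass of the curve and weight of the cone -/

theorem flatMass_le {k : ℕ} {P : ℕ → PolyChain G k} {A : FlatChain G k}
    (hP : Tendsto (fun i => (P i : FlatChain G k)) atTop (𝓝 A)) :
    flatMass A ≤ liminf (fun i => ENNReal.ofReal (polyMass k (P i))) atTop :=
  iInf₂_le P hP

theorem flatWeight_le {k : ℕ} {D : ℕ → Dipolyhedron G k} {A : FlatDipolyhedron G k}
    (hD : Tendsto (fun i => (D i : FlatDipolyhedron G k)) atTop (𝓝 A)) :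
    flatWeight A ≤ liminf (fun i => ENNReal.ofReal (dipolyWeight k (D i))) atTop :=
  iInf₂_le D hD

theorem polyMass_inscribedPolygon_le (g : G) {γ : ℝ → R3} {L : NNReal}
    (hγ : LipschitzOnWith L γ (Set.Icc 0 1)) (n : ℕ) :
    polyMass 1 (inscribedPolygon γ g n) ≤ ‖g‖ * L := by
  rcases Nat.eq_zero_or_pos n with rfl | hn
  · simp only [inscribedPolygon, Finset.range_zero, Finset.sum_empty, map_zero]; positivity
  have hn' : (0 : ℝ) < n := by exact_mod_cast hn
  have key : ∀ i ∈ Finset.range n, polyMass 1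
      (polyMk 1 (Finsupp.single ![γ ((i : ℝ) / n), γ (((i : ℝ) + 1) / n)] g)) ≤
        ‖g‖ * (L * (1 / n)) := by
    intro i hi
    rw [Finset.mem_range] at hi
    refine (polyMass_polyMk_le _).trans ?_
    rw [formalMass_single, simplexVolume_edge]
    refine mul_le_mul_of_nonneg_left ((hγ.dist_le_mul _ (natCast_div_mem_Icc hi.le) _
      (succ_div_mem_Icc hi)).trans (mul_le_mul_of_nonneg_left ?_ L.2)) (norm_nonneg g)
    rw [dist_comm, Real.dist_eq, ← sub_div, add_sub_cancel_left, abs_of_pos (by positivity)]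
  refine (Finset.le_sum_of_subadditive (polyMass 1) (map_zero _).le (map_add_le_add _) _ _).trans
    ((Finset.sum_le_sum key).trans (le_of_eq ?_))
  rw [Finset.sum_const, Finset.card_range, nsmul_eq_mul]
  field_simp

theorem flatMass_curveChain_lt_top (g : G) {γ : ℝ → R3} {L : NNReal}
    (hγ : LipschitzOnWith L γ (Set.Icc 0 1)) : flatMass (curveChain γ g) < ⊤ := by
  refine lt_of_le_of_lt (flatMass_le (tendsto_inscribedPolygon g hγ)) ?_
  refine lt_of_le_of_lt (liminf_le_liminf (v := fun _ => ENNReal.ofReal (‖g‖ * L))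
    (Eventually.of_forall fun n => ?_)) ?_
  · exact ENNReal.ofReal_le_ofReal (polyMass_inscribedPolygon_le g hγ n)
  · rw [liminf_const]
    exact ENNReal.ofReal_lt_top

/-- The inscribed polygons of `γ` have the same flat limit as `P i`, and on them the map is the
ordinary cone. The Lipschitz bound transfers the limit to an arbitrary `P`, whether or not it lies
in the ball. -/
theorem tendsto_polyPushCone {p : R3} {r : ℝ} {f : R3 → R3} (hr : 0 ≤ r) (hf : LipschitzWith 1 f)
    (hK : ∀ x, f x ∈ Metric.closedBall p r) (hfix : ∀ x ∈ Metric.closedBall p r, f x = x) (g : G)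
    {γ : ℝ → R3} {L : NNReal} (hγ : LipschitzOnWith L γ (Set.Icc 0 1))
    (hp : ∀ t ∈ Set.Icc (0 : ℝ) 1, γ t ∈ Metric.closedBall p r) {P : ℕ → PolyChain G 1}
    (hP : Tendsto (fun i => (P i : FlatChain G 1)) atTop (𝓝 (curveChain γ g))) :
    Tendsto (fun i => polyPushCone hr hf hK (P i)) atTop (𝓝 (coneChain p γ g)) := by
  have hpoly : ∀ n, polyPushCone hr hf hK (inscribedPolygon γ g n) =
      polyToFlat 2 (polyCone p 1 (inscribedPolygon γ g n)) := by
    intro n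
    simp only [inscribedPolygon, map_sum]
    refine Finset.sum_congr rfl fun i hi => ?_
    rw [Finset.mem_range] at hi
    exact polyPushCone_edge hr hf hK hfix (hp _ (natCast_div_mem_Icc hi.le))
      (hp _ (succ_div_mem_Icc hi)) g
  have h0 : Tendsto (fun i => 8 * (1 / 2 + r / 6) * ‖P i - inscribedPolygon γ g i‖) atTop
      (𝓝 0) := by
    have h := ((hP.sub (tendsto_inscribedPolygon g hγ)).norm).const_mul (8 * (1 / 2 + r / 6))
    rw [sub_self, norm_zero, mul_zero] at h
    refine h.congr fun i => ?_
    rw [← polyToFlat_apply, ← polyToFlat_apply, ← map_sub, norm_polyToFlat]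
  have h1 := squeeze_zero_norm (fun i => norm_polyPushCone_le hr hf hK _) h0
  have h2 := h1.add (tendsto_polyCone_inscribedPolygon g hγ hr hp)
  rw [zero_add] at h2
  refine h2.congr fun i => ?_
  rw [map_sub, hpoly, ← polyToFlat_apply, sub_add_cancel]

theorem flatDipole_coe (k : ℕ) (P : PolyChain G (k + 1)) :
    flatDipole k (P : FlatChain G (k + 1)) = (dipole k P : FlatDipolyhedron G k) :=
  NormedAddGroupHom.completion_coe _ P

theorem flatDipolyBoundary_coe (k : ℕ) (D : Dipolyhedron G (k + 1)) :
    flatDipolyBoundary k (D : FlatDipolyhedron G (k + 1)) =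
      (dipolyBoundary k D : FlatDipolyhedron G k) :=
  NormedAddGroupHom.completion_coe _ D

theorem tendsto_dipole {k : ℕ} {P : ℕ → PolyChain G (k + 1)} {A : FlatChain G (k + 1)}
    (hP : Tendsto (fun i => (P i : FlatChain G (k + 1))) atTop (𝓝 A)) :
    Tendsto (fun i => (dipole k (P i) : FlatDipolyhedron G k)) atTop (𝓝 (flatDipole k A)) := by
  simp only [← flatDipole_coe]
  exact ((flatDipole k).continuous.tendsto A).comp hP

theorem flatWeight_flatDipole_coneChain_le (g : G) {γ : ℝ → R3} {L : NNReal}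
    (hγ : LipschitzOnWith L γ (Set.Icc 0 1)) {p : R3} {r : ℝ} (hr : 0 < r)
    (hp : ∀ t ∈ Set.Icc (0 : ℝ) 1, γ t ∈ Metric.closedBall p r) :
    flatWeight (flatDipole 1 (coneChain p γ g)) ≤
      ENNReal.ofReal (r / 2) * flatMass (curveChain γ g) := by
  obtain ⟨f, hf, hK, hfix⟩ := exists_nonexpanding_retraction (p := p) hr.le
  have hr0 : ENNReal.ofReal (r / 2) ≠ 0 := (ENNReal.ofReal_pos.2 (half_pos hr)).ne'
  unfold flatMass
  simp only [ENNReal.mul_iInf_of_ne hr0 ENNReal.ofReal_ne_top]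
  refine le_iInf₂ fun P hP => ?_
  have hpos : ∀ i : ℕ, (0 : ℝ) < 1 / ((i : ℝ) + 1) := fun i => Nat.one_div_pos_of_nat
  -- Diagonal choice: `c i` represents `P i` with nearly minimal mass, and `N i` is so large that
  -- the polyhedral cone over the `N i`-fold inscribed image is within `1/(i+1)` of the flat cone
  -- over the image of `P i`.
  choose c hc hcm using fun i => exists_formalMass_lt (P i) (hpos i)
  choose N hN using fun i => (Metric.tendsto_atTop.1 (tendsto_pushCone hr.le hf hK (c i)) _ (hpos i))
  set Q : ℕ → PolyChain G 2 := fun i => polyCone p 1 (inscribedImage f (N i) (c i)) with hQ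
  have hQlim : Tendsto (fun i => (Q i : FlatChain G 2)) atTop (𝓝 (coneChain p γ g)) := by
    have h1 := tendsto_polyPushCone hr.le hf hK hfix g hγ hp hP
    refine h1.congr_dist (squeeze_zero (fun _ => dist_nonneg) (fun i => ?_)
      tendsto_one_div_add_atTop_nhds_zero_nat)
    rw [← hc i, polyPushCone_polyMk, dist_comm]
    exact (hN i (N i) le_rfl).le
  have hQmass : ∀ i, polyMass 2 (Q i) ≤ r / 2 * (polyMass 1 (P i) + 1 / ((i : ℝ) + 1)) := fun i =>
    (polyMass_polyCone_inscribedImage_le hr.le hf hK _ _).trans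
      (mul_le_mul_of_nonneg_left (hcm i).le (half_pos hr).le)
  have hzero : Tendsto (fun i : ℕ => ENNReal.ofReal (1 / ((i : ℝ) + 1))) atTop (𝓝 0) := by
    have h := ENNReal.tendsto_ofReal (tendsto_one_div_add_atTop_nhds_zero_nat (𝕜 := ℝ))
    rwa [ENNReal.ofReal_zero] at h
  refine (flatWeight_le (tendsto_dipole hQlim)).trans ?_
  calc liminf (fun i => ENNReal.ofReal (dipolyWeight 1 (dipole 1 (Q i)))) atTop
      ≤ liminf (fun i => ENNReal.ofReal (r / 2) * (ENNReal.ofReal (polyMass 1 (P i)) +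
          ENNReal.ofReal (1 / ((i : ℝ) + 1)))) atTop := by
        refine liminf_le_liminf (Eventually.of_forall fun i => ?_)
        rw [← ENNReal.ofReal_add (apply_nonneg _ _) (hpos i).le,
          ← ENNReal.ofReal_mul (half_pos hr).le]
        exact ENNReal.ofReal_le_ofReal (hQmass i)
    _ = ENNReal.ofReal (r / 2) * liminf (fun i => ENNReal.ofReal (polyMass 1 (P i)) +
          ENNReal.ofReal (1 / ((i : ℝ) + 1))) atTop :=
        ENNReal.liminf_const_mul_of_ne_top ENNReal.ofReal_ne_top
    _ = ENNReal.ofReal (r / 2) * liminf (fun i => ENNReal.ofReal (polyMass 1 (P i))) atTop := by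
        congr 1
        exact ENNReal.liminf_add_of_right_tendsto_zero hzero _

/-! ### Boundary formula for the cone over a closed curve -/

/-! ### Boundary of the cone -/

theorem polyBoundary_edge (a b : R3) (g : G) :
    polyBoundary 0 (edge a b g) =
      polyMk 0 (Finsupp.single ![b] g) - polyMk 0 (Finsupp.single ![a] g) := by
  have e0 : ![a, b] ∘ Fin.succAbove 0 = ![b] := by ext i; fin_cases i; rfl
  have e1 : ![a, b] ∘ Fin.succAbove 1 = ![a] := by ext i; fin_cases i; rfl
  rw [edge_apply, polyBoundary_polyMk, formalBoundary_single, Fin.sum_univ_two]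
  simp only [e0, e1, map_add, map_zsmul]
  simp
  abel

theorem polyBoundary_inscribedPolygon {γ : ℝ → R3} (hγ : γ 0 = γ 1) (g : G) (n : ℕ) :
    polyBoundary 0 (inscribedPolygon γ g n) = 0 := by
  rcases Nat.eq_zero_or_pos n with rfl | hn
  · simp [inscribedPolygon]
  have hn' : (n : ℝ) ≠ 0 := by exact_mod_cast hn.ne'
  have h := Finset.sum_range_sub
    (fun i : ℕ => polyMk 0 (Finsupp.single ![γ ((i : ℝ) / n)] g)) n
  rw [Nat.cast_zero, zero_div, div_self hn', hγ, sub_self] at h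
  rw [inscribedPolygon, map_sum, ← h]
  refine Finset.sum_congr rfl fun i _ => ?_
  rw [← edge_apply, polyBoundary_edge, Nat.cast_add, Nat.cast_one]

theorem flatDipolyBoundary_flatDipole_coneChain (g : G) {γ : ℝ → R3} {L : NNReal}
    (hγ : LipschitzOnWith L γ (Set.Icc 0 1)) (hclosed : γ 0 = γ 1) {p : R3} {r : ℝ} (hr : 0 ≤ r)
    (hp : ∀ t ∈ Set.Icc (0 : ℝ) 1, γ t ∈ Metric.closedBall p r) :
    flatDipolyBoundary 0 (flatDipole 1 (coneChain p γ g)) = flatDipole 0 (curveChain γ g) := by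
  refine tendsto_nhds_unique (((flatDipolyBoundary 0).continuous.tendsto _).comp
    (tendsto_dipole (tendsto_polyCone_inscribedPolygon g hγ hr hp)))
    ((tendsto_dipole (tendsto_inscribedPolygon g hγ)).congr fun n => ?_)
  rw [Function.comp_apply, flatDipolyBoundary_coe, dipolyBoundary_dipole, polyBoundary_polyCone,
    polyBoundary_inscribedPolygon hclosed, map_zero, sub_zero]

/-! ### Support of the cone -/

theorem isCompact_coneSet (p : R3) {γ : ℝ → R3} (hγ : ContinuousOn γ (Set.Icc 0 1)) :
    IsCompact (coneSet p γ) := by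
  have h : coneSet p γ = (fun st : ℝ × ℝ => AffineMap.lineMap p (γ st.1) st.2) ''
      (Set.Icc 0 1 ×ˢ Set.Icc 0 1) := by
    ext x
    simp only [coneSet, segment_eq_image_lineMap, Set.mem_iUnion, Set.mem_image, Set.mem_prod,
      Prod.exists, exists_prop]
    constructor
    · rintro ⟨s, hs, t, ht, rfl⟩
      exact ⟨s, t, ⟨hs, ht⟩, rfl⟩
    · rintro ⟨s, t, ⟨hs, ht⟩, rfl⟩
      exact ⟨s, hs, t, ht, rfl⟩
  rw [h]
  refine (isCompact_Icc.prod isCompact_Icc).image_of_continuousOn ?_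
  simp only [AffineMap.lineMap_apply_module]
  have hγ' : ContinuousOn (fun st : ℝ × ℝ => γ st.1) (Set.Icc 0 1 ×ˢ Set.Icc 0 1) :=
    hγ.comp continuousOn_fst fun st hst => hst.1
  exact (((continuousOn_const.sub continuousOn_snd).smul continuousOn_const).add
    (continuousOn_snd.smul hγ'))

/-- A closed thickening of a segment is convex, so it suffices to place the three vertices in it;
`b` is at distance `dist a b` from the endpoint `a`. -/
theorem convexHull_triangle_subset (p a b : R3) :
    convexHull ℝ (Set.range (Fin.cons p ![a, b] : Fin 3 → R3)) ⊆
      Metric.cthickening (dist a b) (segment ℝ p a) := by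
  have hconv : Convex ℝ (Metric.cthickening (dist a b) (segment ℝ p a)) :=
    (convex_segment p a).cthickening _
  refine convexHull_min ?_ hconv
  rintro _ ⟨i, rfl⟩
  fin_cases i
  · exact Metric.self_subset_cthickening _ (left_mem_segment ℝ p a)
  · exact Metric.self_subset_cthickening _ (right_mem_segment ℝ p a)
  · exact Metric.mem_cthickening_of_dist_le _ a _ _ (right_mem_segment ℝ p a)
      (dist_comm b a).le

theorem supports_flatDipole_coneChain (g : G) {γ : ℝ → R3} {L : NNReal}
    (hγ : LipschitzOnWith L γ (Set.Icc 0 1)) {p : R3} {r : ℝ} (hr : 0 ≤ r)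
    (hp : ∀ t ∈ Set.Icc (0 : ℝ) 1, γ t ∈ Metric.closedBall p r) :
    Supports (coneSet p γ) (flatDipole 1 (coneChain p γ g)) := by
  have hcomp := isCompact_coneSet p hγ.continuousOn
  refine ⟨hcomp.isClosed, fun U hU hFU => ?_⟩
  obtain ⟨δ, hδ, hδU⟩ := hcomp.exists_cthickening_subset_open hU hFU
  have hlim : Tendsto (fun n : ℕ => (L : ℝ) / n) atTop (𝓝 0) :=
    tendsto_const_div_atTop_nhds_zero_nat _
  obtain ⟨n₀, hn₀⟩ := ((hlim.eventually (gt_mem_nhds hδ)).and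
    (eventually_gt_atTop 0)).exists_forall_of_atTop
  -- The shift by `n₀` makes every term of the sequence lie in `U`, since from `n₀` on the edges are
  -- shorter than `δ`.
  refine ⟨fun i => dipole 1 (polyCone p 1 (inscribedPolygon γ g (i + n₀))), fun i => ⟨?_, ?_⟩,
    tendsto_dipole ((tendsto_polyCone_inscribedPolygon g hγ hr hp).comp
      (tendsto_add_atTop_nat n₀))⟩
  · classical
    obtain ⟨hn, hn'⟩ := hn₀ (i + n₀) (by omega)
    set n := i + n₀
    refine ⟨∑ j ∈ Finset.range n, Finsupp.single
      (Fin.cons p ![γ ((j : ℝ) / n), γ (((j : ℝ) + 1) / n)]) g, ?_, fun σ hσ => ?_⟩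
    · rw [dipolePart_dipole, inscribedPolygon, map_sum, map_sum]
      exact Finset.sum_congr rfl fun j _ => (polyCone_edge p _ _ g).symm
    · obtain ⟨j, hj, hσj⟩ := Finset.mem_biUnion.1 (Finsupp.support_finsetSum hσ)
      rw [Finset.mem_range] at hj
      rw [Finset.mem_singleton.1 (Finsupp.support_single_subset hσj)]
      have h1 := natCast_div_mem_Icc hj.le
      have h2 := succ_div_mem_Icc hj
      have hseg : segment ℝ p (γ ((j : ℝ) / n)) ⊆ coneSet p γ := fun x hx =>
        Set.mem_iUnion₂.2 ⟨_, h1, hx⟩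
      refine (convexHull_triangle_subset p _ _).trans (subset_trans ?_ hδU)
      refine (Metric.cthickening_subset_of_subset _ hseg).trans
        (Metric.cthickening_mono ?_ _)
      refine (hγ.dist_le_mul _ h1 _ h2).trans (le_trans (le_of_eq ?_) hn.le)
      rw [dist_comm, Real.dist_eq, ← sub_div, add_sub_cancel_left,
        abs_of_pos (by positivity), mul_one_div]
  · exact ⟨0, by rw [massPart_dipole, map_zero], by simp⟩

end MainTheorem

theorem mainTheorem4 {G : Type*} [NormedAddCommGroup G] [CompleteSpace G] (g : G)
    (γ : ℝ → R3) (hγ : IsLipschitzJordanCurve γ)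
    (p : R3) (r : ℝ) (hr : γ '' Set.Icc 0 1 ⊆ Metric.closedBall p r) :
    Tendsto (fun n => (inscribedPolygon γ g n : FlatChain G 1)) atTop (𝓝 (curveChain γ g)) ∧
    Tendsto (fun n => (polyCone p 1 (inscribedPolygon γ g n) : FlatChain G 2)) atTop
      (𝓝 (coneChain p γ g)) ∧
    (∃ D : FlatDipolyhedron G 1,
      D = flatDipole 1 (coneChain p γ g) ∧
      Supports (coneSet p γ) D ∧
      flatDipolyBoundary 0 D = flatDipole 0 (curveChain γ g) ∧
      flatWeight D ≤ ENNReal.ofReal (r / 2) * flatMass (curveChain γ g) ∧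
      flatMass (curveChain γ g) < ⊤ ∧
      flatWeight D < ⊤) ∧
    (spanningClass (curveChain γ g)).Nonempty := by
  obtain ⟨⟨L, hL⟩, hclosed, hinj⟩ := hγ
  have hp : ∀ t ∈ Set.Icc (0 : ℝ) 1, γ t ∈ Metric.closedBall p r := fun t ht =>
    hr (Set.mem_image_of_mem γ ht)
  have h0 := hp 0 (by norm_num)
  -- If `r ≤ 0`, the ball contains at most the point `p`, contradicting the injectivity of `γ` at
  -- the parameters `0` and `1/2`.
  have hrpos : 0 < r := by
    by_contra hr0
    have hball : ∀ x ∈ Metric.closedBall p r, x = p := fun x hx =>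
      dist_le_zero.1 (le_trans (Metric.mem_closedBall.1 hx) (not_lt.1 hr0))
    have h := hinj (show (0 : ℝ) ∈ Set.Ico (0 : ℝ) 1 by norm_num)
      (show (1 / 2 : ℝ) ∈ Set.Ico (0 : ℝ) 1 by norm_num)
      ((hball _ h0).trans (hball _ (hp (1 / 2) (by norm_num))).symm)
    norm_num at h
  have hbd := flatDipolyBoundary_flatDipole_coneChain g hL hclosed hrpos.le hp
  have hW := flatWeight_flatDipole_coneChain_le g hL hrpos hp
  have hM := flatMass_curveChain_lt_top g hL
  have hfin := hW.trans_lt (ENNReal.mul_lt_top ENNReal.ofReal_lt_top hM)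
  exact ⟨tendsto_inscribedPolygon g hL, tendsto_polyCone_inscribedPolygon g hL hrpos.le hp,
    ⟨_, rfl, supports_flatDipole_coneChain g hL hrpos.le hp, hbd, hW, hM, hfin⟩, ⟨_, hbd, hfin⟩⟩
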